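/- Let $k$ be an algebraically closed field of characteristic zero, $N\cong\mathbb{Z}^n$ a lattice, $M=\mathrm{Hom}_{\mathbb Z}(N,\mathbb{Z})$ its dual, $N_{\mathbb R}=N\otimes_{\mathbb Z}\mathbb{R}$ and $M_{\mathbb R}=M\otimes_{\mathbb Z}\mathbb{R}$. Let $\sigma\subset N_{\mathbb R}$ be a convex cone that is generated by finitely many vectors of $N$, contains no nonzero linear subspace and spans $N_{\mathbb R}$; let $\sigma^\vee\subset M_{\mathbb R}$ be its dual cone, $X=\mathrm{Spec}\,k[M\cap\sigma^\vee]$ the associated affine toric variety, with monomials $\chi^u$, and $T=\mathrm{Spec}\,k[M]$ its torus. For $m\ge 0$ let $X_m$ and $T_m$ be the $m$-th jet schemes of $X$ and $T$ (we consider $k$-valued points with the Zariski topology, i.e. $k$-algebra homomorphisms $\gamma^*$ from the coordinate ring to $k[t]/(t^{m+1})$). The group $T_m$ acts on $X_m$ by $(g\cdot\gamma)^*(\chi^u)=g^*(\chi^u)\,\gamma^*(\chi^u)$. For a lattice point $a\in\sigma\cap N$, let $T_{m,a}\subset X_m$ be the $T_m$-orbit corresponding to $a$: the set of the $m$-jets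 $\gamma$ that lift to an arc $\delta$ of $X$, $\delta^*\colon k[M\cap\sigma^\vee]\to k[[t]]$, such that for every $u\in M\cap\sigma^\vee$ one has $\delta^*(\chi^u)\neq 0$, and either $\mathrm{ord}_t\,\delta^*(\chi^u)=\langle a,u\rangle\le m$, or both $\mathrm{ord}_t\,\delta^*(\chi^u)$ and $\langle a,u\rangle$ are larger than $m$. Let $u_1,\dots,u_s\in M\cap\sigma^\vee$ be such that $\chi^{u_1},\dots,\chi^{u_s}$ is the minimal set of monomial generators of $k[M\cap\sigma^\vee]$. Fix a lattice point $a$ in the interior of $\sigma$ and $m\ge 0$, and let $H_{m,a}\subset T_m$ be the stabilizer of an arbitrary element of $T_{m,a}$. Put $$\Phi(a)=\min\Big\{\sum_{i=1}^n\langle a,v_i\rangle \;\Big|\; v_1,\dots,v_n\in M\cap\sigma^\vee\text{ span }M_{\mathbb R}\Big\}$$ (this minimum exists), and consider the inequality $$(\ast)\qquad m\ \ge\ \max\,\langle a,u_{j_i}\rangle,$$ where the maximum is over all $1\le i\le n$ and all choices of $n$ vectors $u_{j_1},\dots,u_{j_n}$ among $u_1,\dots,u_s$ that span $M_{\mathbb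 R}$ and satisfy $\sum_{i=1}^n\langle a,u_{j_i}\rangle=\Phi(a)$. Then: (1) If $m$ satisfies $(\ast)$, then $\dim H_{m,a}=\Phi(a)$. (2) If $m$ does not satisfy $(\ast)$, then either $\dim H_{m,a}=\Phi(a)$ or $m\le\dim H_{m,a}\le\Phi(a)$. -/

import Mathlib

open scoped TensorProduct

noncomputable section

/-! ## Jets of affine schemes -/

/-- The ring `A[t]/(t^(m+1))`. -/
abbrev JetRing (A : Type*) [CommRing A] (m : ℕ) : Type _ :=
  Polynomial A ⧸ Ideal.span {(Polynomial.X : Polynomial A) ^ (m + 1)}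

namespace JetRing

variable {A : Type*} [CommRing A] {m : ℕ}

/-- The class of a polynomial in `A[t]/(t^(m+1))`. -/
def mk (m : ℕ) (f : Polynomial A) : JetRing A m := Ideal.Quotient.mk _ f

theorem mk_surjective : Function.Surjective (mk m : Polynomial A → JetRing A m) :=
  Ideal.Quotient.mk_surjective

theorem mk_eq_mk {f g : Polynomial A} :
    mk m f = mk m g ↔ ∀ j < m + 1, f.coeff j = g.coeff j := by
  unfold mk
  rw [Ideal.Quotient.eq, Ideal.mem_span_singleton, Polynomial.X_pow_dvd_iff]
  simp [sub_eq_zero]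

/-- The coefficient of `t^j` of an element of `A[t]/(t^(m+1))`, for `0 ≤ j ≤ m`. -/
def coeff (x : JetRing A m) (j : Fin (m + 1)) : A :=
  Quotient.liftOn' x (fun f : Polynomial A => f.coeff j) (fun _ _ h =>
    (mk_eq_mk (m := m)).1 (Quotient.sound' h) j j.2)

@[simp] theorem coeff_mk (f : Polynomial A) (j : Fin (m + 1)) : (mk m f).coeff j = f.coeff j := rfl

theorem ext {x y : JetRing A m} (h : ∀ j, x.coeff j = y.coeff j) : x = y := by
  obtain ⟨f, rfl⟩ := mk_surjective x
  obtain ⟨g, rfl⟩ := mk_surjective y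
  exact mk_eq_mk.2 fun j hj => h ⟨j, hj⟩

@[simp] theorem coeff_add (x y : JetRing A m) (j : Fin (m + 1)) :
    (x + y).coeff j = x.coeff j + y.coeff j := by
  obtain ⟨f, rfl⟩ := mk_surjective x
  obtain ⟨g, rfl⟩ := mk_surjective y
  exact Polynomial.coeff_add f g j

theorem sum_antidiagonal_eq (m : ℕ) (F : ℕ → ℕ → A) (j : Fin (m + 1)) :
    ∑ p ∈ Finset.HasAntidiagonal.antidiagonal (j : ℕ), F p.1 p.2 =
      ∑ p : Fin (m + 1) × Fin (m + 1) with (p.1 : ℕ) + p.2 = j, F p.1 p.2 := by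
  symm
  refine Finset.sum_bij (fun p _ => ((p.1 : ℕ), (p.2 : ℕ))) ?_ ?_ ?_ ?_
  · intro p hp; simpa using hp
  · rintro ⟨a, b⟩ _ ⟨c, d⟩ _ h
    simp only [Prod.mk.injEq] at h
    exact Prod.ext (Fin.ext h.1) (Fin.ext h.2)
  · rintro ⟨a, b⟩ h
    have hj := j.2
    rw [Finset.HasAntidiagonal.mem_antidiagonal] at h
    dsimp only at h
    exact ⟨(⟨a, by omega⟩, ⟨b, by omega⟩), by simpa using h, rfl⟩
  · intro p _; rfl

theorem coeff_mul (x y : JetRing A m) (j : Fin (m + 1)) :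
    (x * y).coeff j =
      ∑ p : Fin (m + 1) × Fin (m + 1) with (p.1 : ℕ) + p.2 = j, x.coeff p.1 * y.coeff p.2 := by
  obtain ⟨f, rfl⟩ := mk_surjective x
  obtain ⟨g, rfl⟩ := mk_surjective y
  have h : mk m f * mk m g = mk m (f * g) := (map_mul (Ideal.Quotient.mk _) f g).symm
  rw [h, coeff_mk, Polynomial.coeff_mul]
  exact sum_antidiagonal_eq m (fun p q => f.coeff p * g.coeff q) j

theorem coeff_algebraMap {k : Type*} [CommRing k] [Algebra k A] (c : k) (j : Fin (m + 1)) :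
    (algebraMap k (JetRing A m) c).coeff j = if j = 0 then algebraMap k A c else 0 := by
  have h : algebraMap k (JetRing A m) c = mk m (Polynomial.C (algebraMap k A c)) := rfl
  rw [h, coeff_mk, Polynomial.coeff_C]
  simp only [← Fin.val_eq_zero_iff]

/-- The element `∑ a_j t^j` of `A[t]/(t^(m+1))`. -/
def ofCoeff (a : Fin (m + 1) → A) : JetRing A m :=
  mk m (∑ j : Fin (m + 1), Polynomial.monomial (j : ℕ) (a j))

@[simp] theorem coeff_ofCoeff (a : Fin (m + 1) → A) (j : Fin (m + 1)) :
    (ofCoeff a).coeff j = a j := by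
  simp [ofCoeff, Polynomial.coeff_monomial, ← Fin.ext_iff]

end JetRing

section JetAlgebra

variable (k : Type*) [CommRing k] (m : ℕ) (R : Type*) [CommRing R] [Algebra k R]

/-- The relations that the coefficients `r^(j)` of the universal `m`-jet
`r ↦ r^(0) + r^(1) t + ⋯ + r^(m) t^m` have to satisfy. -/
def jetIdeal : Ideal (MvPolynomial (R × Fin (m + 1)) k) :=
  Ideal.span
    ({f | ∃ (r s : R) (j : Fin (m + 1)),
        f = MvPolynomial.X (r + s, j) - (MvPolynomial.X (r, j) + MvPolynomial.X (s, j))} ∪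
     {f | ∃ (r s : R) (j : Fin (m + 1)),
        f = MvPolynomial.X (r * s, j) -
          ∑ p : Fin (m + 1) × Fin (m + 1) with (p.1 : ℕ) + p.2 = j,
            MvPolynomial.X (r, p.1) * MvPolynomial.X (s, p.2)} ∪
     {f | ∃ (c : k) (j : Fin (m + 1)),
        f = MvPolynomial.X (algebraMap k R c, j) - if j = 0 then MvPolynomial.C c else 0})

/-- The coordinate ring of the `m`-th jet scheme of `Spec R`; see `jetEquiv`. -/
abbrev JetAlgebra : Type _ := MvPolynomial (R × Fin (m + 1)) k ⧸ jetIdeal k m R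

variable {R} in
/-- The coordinate `r^(j)` on the jet scheme. -/
def jetCoord (r : R) (j : Fin (m + 1)) : JetAlgebra k m R :=
  Ideal.Quotient.mk (jetIdeal k m R) (MvPolynomial.X (r, j))

variable {k m R}

theorem jetCoord_add (r s : R) (j : Fin (m + 1)) :
    jetCoord k m (r + s) j = jetCoord k m r j + jetCoord k m s j :=
  ((Ideal.Quotient.eq (I := jetIdeal k m R)).2 (Ideal.subset_span (Or.inl (Or.inl ⟨r, s, j, rfl⟩)))).trans
    (map_add _ _ _)

theorem jetCoord_mul (r s : R) (j : Fin (m + 1)) :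
    jetCoord k m (r * s) j = ∑ p : Fin (m + 1) × Fin (m + 1) with (p.1 : ℕ) + p.2 = j,
      jetCoord k m r p.1 * jetCoord k m s p.2 :=
  ((Ideal.Quotient.eq (I := jetIdeal k m R)).2 (Ideal.subset_span (Or.inl (Or.inr ⟨r, s, j, rfl⟩)))).trans
    (by simp [jetCoord, map_sum])

theorem jetCoord_algebraMap (c : k) (j : Fin (m + 1)) :
    jetCoord k m (algebraMap k R c) j = if j = 0 then algebraMap k _ c else 0 :=
  ((Ideal.Quotient.eq (I := jetIdeal k m R)).2 (Ideal.subset_span (Or.inr ⟨c, j, rfl⟩))).trans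
    (by split_ifs <;> rfl)

/-- `A`-valued points of `Spec (JetAlgebra k m R)` are the `A`-valued `m`-jets of `Spec R`: the
homomorphism `φ` corresponds to the jet `r ↦ φ(r^(0)) + φ(r^(1)) t + ⋯ + φ(r^(m)) t^m`.
So `Spec (JetAlgebra k m R)` is the `m`-th jet scheme of `Spec R`. -/
def jetEquiv (A : Type*) [CommRing A] [Algebra k A] :
    (JetAlgebra k m R →ₐ[k] A) ≃ (R →ₐ[k] JetRing A m) where
  toFun φ :=
    AlgHom.ofLinearMap
      { toFun := fun r => JetRing.ofCoeff fun j => φ (jetCoord k m r j)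
        map_add' := fun r s => JetRing.ext fun j => by simp [jetCoord_add]
        map_smul' := fun c r => JetRing.ext fun j => by
          simp only [Algebra.smul_def, jetCoord_mul, jetCoord_algebraMap, JetRing.coeff_ofCoeff,
            RingHom.id_apply, JetRing.coeff_mul, JetRing.coeff_algebraMap, map_sum, map_mul]
          refine Finset.sum_congr rfl fun p _ => ?_
          split_ifs <;> simp }
      (JetRing.ext fun j => by
        have h1 := JetRing.coeff_algebraMap (A := A) (m := m) (1 : k) j
        have h2 := jetCoord_algebraMap (R := R) (m := m) (1 : k) j
        simp only [map_one] at h1 h2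
        simp only [LinearMap.coe_mk, AddHom.coe_mk, JetRing.coeff_ofCoeff, h1, h2]
        split_ifs <;> simp)
      (fun r s => JetRing.ext fun j => by
        simp [jetCoord_mul, JetRing.coeff_mul])
  invFun γ := Ideal.Quotient.liftₐ (jetIdeal k m R)
    (MvPolynomial.aeval fun p : R × Fin (m + 1) => (γ p.1).coeff p.2) (by
      intro f hf
      change f ∈ RingHom.ker (MvPolynomial.aeval fun p : R × Fin (m + 1) => (γ p.1).coeff p.2)
      revert f
      change jetIdeal k m R ≤ _
      rw [jetIdeal, Ideal.span_le]
      rintro f ((⟨r, s, j, rfl⟩ | ⟨r, s, j, rfl⟩) | ⟨c, j, rfl⟩)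
      · simp [RingHom.mem_ker]
      · simp [RingHom.mem_ker, JetRing.coeff_mul]
      · have := JetRing.coeff_algebraMap (A := A) (m := m) c j
        simp only [SetLike.mem_coe, RingHom.mem_ker, map_sub, MvPolynomial.aeval_X,
          AlgHom.commutes, this]
        split_ifs <;> simp)
  left_inv φ := by
    apply Ideal.Quotient.algHom_ext
    apply MvPolynomial.algHom_ext
    rintro ⟨r, j⟩
    simp only [AlgHom.comp_apply, Ideal.Quotient.mkₐ_eq_mk, Ideal.Quotient.liftₐ_apply]
    exact (Ideal.Quotient.lift_mk _ _ _).trans (by simp [jetCoord])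
  right_inv γ := by
    apply AlgHom.ext
    intro r
    apply JetRing.ext
    intro j
    refine (JetRing.coeff_ofCoeff _ j).trans ?_
    refine (Ideal.Quotient.lift_mk _ _ _).trans ?_
    simp

end JetAlgebra

/-- The `m`-jets (i.e. the `k`-valued points of the `m`-th jet scheme) of `Spec R`. -/
@[ext]
structure JetPoint (k : Type*) [CommRing k] (m : ℕ) (R : Type*) [CommRing R] [Algebra k R] where
  /-- The homomorphism `γ^*` of the jet `γ : Spec k[t]/(t^(m+1)) → Spec R`. -/
  hom : R →ₐ[k] JetRing k m

/-- A `k`-valued point of the jet scheme, as a point of the scheme. -/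
def JetPoint.toSpec {k : Type*} [Field k] {m : ℕ} {R : Type*} [CommRing R] [Algebra k R]
    (γ : JetPoint k m R) : PrimeSpectrum (JetAlgebra k m R) :=
  ⟨RingHom.ker ((jetEquiv k).symm γ.hom), RingHom.ker_isPrime _⟩

/-- The Zariski topology on the set of `k`-valued points of the jet scheme. -/
instance JetPoint.instTopologicalSpace {k : Type*} [Field k] {m : ℕ} {R : Type*} [CommRing R]
    [Algebra k R] : TopologicalSpace (JetPoint k m R) :=
  TopologicalSpace.induced JetPoint.toSpec inferInstance

/-- The `k`-valued arcs of `Spec R`. -/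
abbrev ArcPoint (k : Type*) [CommRing k] (R : Type*) [CommRing R] [Algebra k R] : Type _ :=
  R →ₐ[k] PowerSeries k

/-- The truncation `k⟦t⟧ → k[t]/(t^(m+1))`. -/
def truncHom (k : Type*) [CommRing k] (m : ℕ) : PowerSeries k →ₐ[k] JetRing k m :=
  AlgHom.ofLinearMap
    { toFun := fun f => JetRing.ofCoeff fun j => PowerSeries.coeff (j : ℕ) f
      map_add' := fun f g => JetRing.ext fun j => by simp
      map_smul' := fun c f => JetRing.ext fun j => by
        obtain ⟨p, hp⟩ := JetRing.mk_surjective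
          (JetRing.ofCoeff fun j : Fin (m + 1) => PowerSeries.coeff (j : ℕ) f)
        have h : c • JetRing.mk m p = JetRing.mk m (c • p) := rfl
        have h2 := congrArg (fun x => JetRing.coeff x j) hp
        simp only [JetRing.coeff_ofCoeff, JetRing.coeff_mk] at h2
        simp only [RingHom.id_apply]
        rw [← hp, h]
        simp [h2] }
    (JetRing.ext fun j => by
      have h := JetRing.coeff_algebraMap (A := k) (m := m) (1 : k) j
      simp only [map_one] at h
      simp only [LinearMap.coe_mk, AddHom.coe_mk, JetRing.coeff_ofCoeff, h,
        PowerSeries.coeff_one, ← Fin.val_eq_zero_iff])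
    (fun f g => JetRing.ext fun j => by
      simp only [LinearMap.coe_mk, AddHom.coe_mk, JetRing.coeff_ofCoeff, JetRing.coeff_mul,
        PowerSeries.coeff_mul]
      exact JetRing.sum_antidiagonal_eq m
        (fun p q => PowerSeries.coeff p f * PowerSeries.coeff q g) j)

/-- The canonical map `ψ_m` from arcs to `m`-jets. -/
def ArcPoint.toJet {k : Type*} [CommRing k] {R : Type*} [CommRing R] [Algebra k R] (m : ℕ)
    (δ : ArcPoint k R) : JetPoint k m R :=
  ⟨(truncHom k m).comp δ⟩

/-! ## Cones, toric varieties and the torus action on jets -/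

section Toric

variable {N : Type*} [AddCommGroup N]

/-- `σ` is generated, as a convex cone in `N_ℝ = ℝ ⊗ N`, by finitely many lattice vectors. -/
def IsRationalPolyhedral (σ : PointedCone ℝ (ℝ ⊗[ℤ] N)) : Prop :=
  ∃ S : Finset N, σ = PointedCone.hull ℝ ((fun v : N => (1 : ℝ) ⊗ₜ[ℤ] v) '' (S : Set N))

/-- The interior of `σ` in the canonical (module) topology of the real vector space `N_ℝ`. -/
def coneInterior (σ : PointedCone ℝ (ℝ ⊗[ℤ] N)) : Set (ℝ ⊗[ℤ] N) :=
  @interior (ℝ ⊗[ℤ] N) (moduleTopology ℝ (ℝ ⊗[ℤ] N)) (σ : Set (ℝ ⊗[ℤ] N))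

/-- The semigroup `M ∩ σ^∨`, where `M = Hom(N, ℤ)`. -/
def dualMonoid (σ : PointedCone ℝ (ℝ ⊗[ℤ] N)) : AddSubmonoid (Module.Dual ℤ N) where
  carrier := {u | ∀ v ∈ σ, 0 ≤ Module.Dual.baseChange ℝ u v}
  zero_mem' := fun v _ => by simp
  add_mem' := fun {u w} hu hw v hv => by simpa using add_nonneg (hu v hv) (hw v hv)

/-- The monomial `χ^u`. -/
def chi (k : Type*) [CommRing k] {S : Type*} [AddCommMonoid S] (u : S) : AddMonoidAlgebra k S :=
  AddMonoidAlgebra.single u 1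

theorem chi_zero (k : Type*) [CommRing k] {S : Type*} [AddCommMonoid S] :
    chi k (0 : S) = 1 := rfl

theorem chi_add (k : Type*) [CommRing k] {S : Type*} [AddCommMonoid S] (u v : S) :
    chi k (u + v) = chi k u * chi k v := by
  simp [chi, AddMonoidAlgebra.single_mul_single]

/-- The `k`-algebra homomorphism out of `k[S]` with prescribed values on the monomials. -/
def ofMonomials {k : Type*} [CommRing k] {S : Type*} [AddCommMonoid S] {B : Type*} [CommRing B]
    [Algebra k B] (f : S → B) (h0 : f 0 = 1) (hadd : ∀ u v, f (u + v) = f u * f v) :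
    AddMonoidAlgebra k S →ₐ[k] B :=
  AddMonoidAlgebra.lift k B S
    { toFun := fun u => f u.toAdd, map_one' := h0, map_mul' := fun u v => hadd u.toAdd v.toAdd }

@[simp] theorem ofMonomials_chi {k : Type*} [CommRing k] {S : Type*} [AddCommMonoid S] {B : Type*}
    [CommRing B] [Algebra k B] (f : S → B) (h0 : f 0 = 1)
    (hadd : ∀ u v, f (u + v) = f u * f v) (u : S) :
    ofMonomials (k := k) f h0 hadd (chi k u) = f u := by
  simp [ofMonomials, chi]

theorem algHom_ext_chi {k : Type*} [CommRing k] {S : Type*} [AddCommMonoid S] {B : Type*}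
    [CommRing B] [Algebra k B] {f g : AddMonoidAlgebra k S →ₐ[k] B}
    (h : ∀ u, f (chi k u) = g (chi k u)) : f = g :=
  AddMonoidAlgebra.algHom_ext h (Subsingleton.elim _ _)

section Action

variable {k : Type*} [Field k] {m : ℕ} {M : Type*} [AddCommGroup M]

/-- The product in `T_m`: `(g * h)(χ^u) = g(χ^u) h(χ^u)`. -/
def JetPoint.mul (g h : JetPoint k m (AddMonoidAlgebra k M)) :
    JetPoint k m (AddMonoidAlgebra k M) where
  hom := ofMonomials (fun u => g.hom (chi k u) * h.hom (chi k u))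
    (by simp [chi_zero]) (fun u v => by simp only [chi_add, map_mul]; ring)

/-- The unit element of `T_m`: `1(χ^u) = 1`. -/
def JetPoint.one : JetPoint k m (AddMonoidAlgebra k M) where
  hom := ofMonomials (fun _ => 1) rfl (by simp)

/-- The inverse in `T_m`: `g⁻¹(χ^u) = g(χ^(-u))`. -/
def JetPoint.inv (g : JetPoint k m (AddMonoidAlgebra k M)) :
    JetPoint k m (AddMonoidAlgebra k M) where
  hom := ofMonomials (fun u => g.hom (chi k (-u)))
    (by simp [chi_zero]) (fun u v => by rw [neg_add, chi_add, map_mul])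

/-- The action of `T_m` on jets: `(g • γ)(χ^u) = g(χ^u) γ(χ^u)`. -/
def JetPoint.smul {S : AddSubmonoid M} (g : JetPoint k m (AddMonoidAlgebra k M))
    (γ : JetPoint k m (AddMonoidAlgebra k S)) : JetPoint k m (AddMonoidAlgebra k S) where
  hom := ofMonomials (fun u => g.hom (chi k (u : M)) * γ.hom (chi k u))
    (by simp [chi_zero])
    (fun u v => by rw [AddSubmonoid.coe_add]; simp only [chi_add, map_mul]; ring)

instance JetPoint.instMul : Mul (JetPoint k m (AddMonoidAlgebra k M)) := ⟨JetPoint.mul⟩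

instance JetPoint.instOne : One (JetPoint k m (AddMonoidAlgebra k M)) := ⟨JetPoint.one⟩

instance JetPoint.instInv : Inv (JetPoint k m (AddMonoidAlgebra k M)) := ⟨JetPoint.inv⟩

instance JetPoint.instSMul (S : AddSubmonoid M) :
    SMul (JetPoint k m (AddMonoidAlgebra k M)) (JetPoint k m (AddMonoidAlgebra k S)) :=
  ⟨JetPoint.smul⟩

theorem JetPoint.mul_chi (g h : JetPoint k m (AddMonoidAlgebra k M)) (u : M) :
    (g * h).hom (chi k u) = g.hom (chi k u) * h.hom (chi k u) := by
  change (JetPoint.mul g h).hom (chi k u) = _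
  rw [JetPoint.mul, ofMonomials_chi]

theorem JetPoint.one_chi (u : M) :
    (1 : JetPoint k m (AddMonoidAlgebra k M)).hom (chi k u) = 1 := by
  change (JetPoint.one).hom (chi k u) = _
  rw [JetPoint.one, ofMonomials_chi]

theorem JetPoint.inv_chi (g : JetPoint k m (AddMonoidAlgebra k M)) (u : M) :
    g⁻¹.hom (chi k u) = g.hom (chi k (-u)) := by
  change (JetPoint.inv g).hom (chi k u) = _
  rw [JetPoint.inv, ofMonomials_chi]

theorem JetPoint.smul_chi (S : AddSubmonoid M) (g : JetPoint k m (AddMonoidAlgebra k M))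
    (γ : JetPoint k m (AddMonoidAlgebra k S)) (u : S) :
    (g • γ).hom (chi k u) = g.hom (chi k (u : M)) * γ.hom (chi k u) := by
  change (JetPoint.smul g γ).hom (chi k u) = _
  rw [JetPoint.smul, ofMonomials_chi]

theorem JetPoint.ext_chi {S : Type*} [AddCommMonoid S] {g h : JetPoint k m (AddMonoidAlgebra k S)}
    (H : ∀ u, g.hom (chi k u) = h.hom (chi k u)) : g = h :=
  JetPoint.ext (algHom_ext_chi H)

/-- The group `T_m` of `m`-jets of the torus `T = Spec k[M]`; its multiplication is induced by the
one of `T`, i.e. `(g * h)(χ^u) = g(χ^u) h(χ^u)`. -/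
instance JetPoint.instCommGroup : CommGroup (JetPoint k m (AddMonoidAlgebra k M)) where
  mul_assoc f g h := ext_chi fun u => by simp only [mul_chi, mul_assoc]
  one_mul g := ext_chi fun u => by rw [mul_chi, one_chi, one_mul]
  mul_one g := ext_chi fun u => by rw [mul_chi, one_chi, mul_one]
  mul_comm g h := ext_chi fun u => by rw [mul_chi, mul_chi, mul_comm]
  inv_mul_cancel g := ext_chi fun u => by
    rw [mul_chi, inv_chi, one_chi, ← map_mul, ← chi_add, neg_add_cancel, chi_zero, map_one]

/-- The action of `T_m` on the `m`-jets of `Spec k[S]`, for a subsemigroup `S` of `M`, induced by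
the torus action `χ^u ↦ χ^u ⊗ χ^u`, i.e. `(g • γ)(χ^u) = g(χ^u) γ(χ^u)`. -/
instance JetPoint.instMulAction (S : AddSubmonoid M) :
    MulAction (JetPoint k m (AddMonoidAlgebra k M)) (JetPoint k m (AddMonoidAlgebra k S)) where
  one_smul γ := ext_chi fun u => by rw [smul_chi, one_chi, one_mul]
  mul_smul g h γ := ext_chi fun u => by simp only [smul_chi, mul_chi, mul_assoc]

end Action

/-- The truncation `Tr_m`, sending every order larger than `m` to `∞`. -/
def truncOrd (m : ℕ) (e : ℕ∞) : ℕ∞ := if e ≤ m then e else ⊤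

/-- The `T_m`-orbit `T_{m,a}`: the set of the `m`-jets `γ` of `X = Spec k[M ∩ σ^∨]` that lift to
an arc `δ` lying in no arc space `(D_i)_∞` of a torus-invariant prime divisor `D_i` of `X` (i.e.
`δ(χ^u) ≠ 0` for all `u`), and whose order map `u ↦ Tr_m (ord_t δ(χ^u))` is the truncation of
`u ↦ ⟨a, u⟩`. (For `a ∈ σ` the integer `⟨a, u⟩` is nonnegative.) -/
def jetOrbit (k : Type*) [Field k] (σ : PointedCone ℝ (ℝ ⊗[ℤ] N)) (m : ℕ) (a : N) :
    Set (JetPoint k m (AddMonoidAlgebra k (dualMonoid σ))) :=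
  {γ | ∃ δ : ArcPoint k (AddMonoidAlgebra k (dualMonoid σ)),
    (∀ u, δ (chi k u) ≠ 0) ∧ δ.toJet m = γ ∧
    ∀ u : dualMonoid σ, truncOrd m (δ (chi k u)).order =
      truncOrd m (((u : Module.Dual ℤ N) a).toNat : ℕ∞)}

theorem dualMonoid_apply_nonneg {σ : PointedCone ℝ (ℝ ⊗[ℤ] N)} {a : N}
    (ha : (1 : ℝ) ⊗ₜ[ℤ] a ∈ σ) (u : dualMonoid σ) : 0 ≤ (u : Module.Dual ℤ N) a := by
  have h := u.2 _ ha
  simpa using h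

/-- `T_{m,a}` is not empty: it contains the jet `χ^u ↦ t^⟨a, u⟩`. -/
theorem jetOrbit_nonempty (k : Type*) [Field k] (σ : PointedCone ℝ (ℝ ⊗[ℤ] N)) (m : ℕ) {a : N}
    (ha : (1 : ℝ) ⊗ₜ[ℤ] a ∈ σ) : (jetOrbit k σ m a).Nonempty := by
  refine ⟨_, ofMonomials (fun u => (PowerSeries.X : PowerSeries k) ^
    ((u : Module.Dual ℤ N) a).toNat) (by simp) (fun u v => ?_), fun u => ?_, rfl, fun u => ?_⟩
  · rw [← pow_add, ← Int.toNat_add (dualMonoid_apply_nonneg ha u) (dualMonoid_apply_nonneg ha v)]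
    rfl
  · rw [ofMonomials_chi]
    exact pow_ne_zero _ PowerSeries.X_ne_zero
  · rw [ofMonomials_chi, PowerSeries.order_X_pow]

/-- The vectors `u_1, …, u_n` of `M ∩ σ^∨`, with `n` the rank of `N`, span `M_ℝ = ℝ ⊗ M`. -/
def IsSpanningTuple {σ : PointedCone ℝ (ℝ ⊗[ℤ] N)}
    (u : Fin (Module.finrank ℤ N) → dualMonoid σ) : Prop :=
  Submodule.span ℝ
    (Set.range fun i => (1 : ℝ) ⊗ₜ[ℤ] (u i : Module.Dual ℤ N)) = ⊤

/-- The set of the values `⟨a, u_1⟩ + ⋯ + ⟨a, u_n⟩`, for `u_1, …, u_n ∈ M ∩ σ^∨` that span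
`M_ℝ`. -/
def spanningSums (σ : PointedCone ℝ (ℝ ⊗[ℤ] N)) (a : N) : Set ℤ :=
  {s | ∃ u : Fin (Module.finrank ℤ N) → dualMonoid σ,
    IsSpanningTuple u ∧ s = ∑ i, (u i : Module.Dual ℤ N) a}

/-- `Φ(a)`, the minimum of `spanningSums σ a`. -/
def Phi (σ : PointedCone ℝ (ℝ ⊗[ℤ] N)) (a : N) : ℤ := sInf (spanningSums σ a)

/-- The set of the integers `⟨a, u_{j_i}⟩`, where `u_{j_1}, …, u_{j_n}` runs over the tuples of
elements of `G` that span `M_ℝ` and attain the minimum `Φ(a)`. -/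
def minimizingValues (σ : PointedCone ℝ (ℝ ⊗[ℤ] N)) (G : Set (dualMonoid σ)) (a : N) : Set ℤ :=
  {s | ∃ u : Fin (Module.finrank ℤ N) → dualMonoid σ,
    (∀ i, u i ∈ G) ∧ IsSpanningTuple u ∧ ∑ i, (u i : Module.Dual ℤ N) a = Phi σ a ∧
    ∃ i, s = (u i : Module.Dual ℤ N) a}

/-- `G` is the minimal set of semigroup elements whose monomials generate `k[M ∩ σ^∨]`. -/
def IsMinimalMonomialGenerators (k : Type*) [Field k] (σ : PointedCone ℝ (ℝ ⊗[ℤ] N))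
    (G : Set (dualMonoid σ)) : Prop :=
  Minimal (fun G : Set (dualMonoid σ) => Algebra.adjoin k (chi k '' G) = ⊤) G

end Toric

end

/-! Let `γ` lie in the orbit of `a`. Since `γ(χ^u)` is zero or has order `⟨a,u⟩ ≤ m`, a jet `g` of
the torus fixes `γ` exactly when `g(χ^u) ≡ 1` modulo `t^(m+1-⟨a,u⟩)` for all `u` in the semigroup
with `⟨a,u⟩ ≤ m` (`mem_stabilizer_jetOrbit_iff`). To solve these congruences together, filter `M` by
the saturations `F_j` of the sublattices generated by the generators of weight `⟨a,u⟩ ≤ j`, and take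
a basis `b_i` of `M` adapted to this filtration, with weights `w_i`
(`exists_basis_adapted_to_weights`).

Each `u` is a combination of the `b_i` with `w_i ≤ ⟨a,u⟩`, so it is enough that `g(χ^(b_i)) ≡ 1`
modulo `t^(m+1-w_i)` whenever `w_i ≤ m`. Conversely, a nonzero multiple of `b_i` is a combination of
generators of weight at most `w_i`, so a power of `g(χ^(b_i))` is congruent to `1`; in
characteristic zero `g(χ^(b_i))` is then congruent to a root of unity. Up to finitely many choices
of such roots, the `i`-th value has `min(w_i, m+1)` free coefficients, hence the dimension is `∑
min(w_i, m+1)` (`topologicalKrullDim_stabilizer`).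

On the other hand `Φ(a) = ∑ w_i`: a nonzero term in the Leibniz expansion of a determinant gives the
lower bound (`sum_weights_le`), and an exchange argument produces generators of weights exactly
`w_i` that span (`exists_spanningTuple_weights`). These weights therefore occur among the values
bounded in `(∗)`, and comparing the two sums gives both claims. -/

noncomputable section

/-! ### Zariski topology on sets of `k`-points, and rational functions -/

section Zariski

open scoped Topology

variable {k : Type*} [Field k]

/-- A `k`-valued point of `Spec A`, as a point of the prime spectrum. -/
def AlgHom.toPrimeSpectrum {A : Type*} [CommRing A] [Algebra k A] (φ : A →ₐ[k] k) :
    PrimeSpectrum A :=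
  ⟨RingHom.ker φ, RingHom.ker_isPrime _⟩

/-- Lets jets, affine points and subsets of them be treated alike, through zero loci of functions,
without passing to the scheme. -/
theorem isClosed_induced_toPrimeSpectrum_iff {X A : Type*} [CommRing A] [Algebra k A]
    (ev : X → A →ₐ[k] k) {C : Set X} :
    IsClosed[TopologicalSpace.induced (fun x => (ev x).toPrimeSpectrum) inferInstance] C ↔
      ∃ s : Set A, C = {x | ∀ f ∈ s, ev x f = 0} := by
  rw [isClosed_induced_iff]
  constructor
  · rintro ⟨t, ht, rfl⟩
    obtain ⟨s, rfl⟩ := (PrimeSpectrum.isClosed_iff_zeroLocus _).1 ht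
    exact ⟨s, rfl⟩
  · rintro ⟨s, rfl⟩
    exact ⟨_, PrimeSpectrum.isClosed_zeroLocus s, rfl⟩

/-- The points of the affine space `k^E`, with the Zariski topology. -/
def AffinePoints (k E : Type*) : Type _ := E → k

/-- The evaluation of polynomials at a point of the affine space. -/
def AffinePoints.eval {E : Type*} (x : AffinePoints k E) : MvPolynomial E k →ₐ[k] k :=
  MvPolynomial.aeval (fun e => x e)

instance AffinePoints.instTopologicalSpace (E : Type*) : TopologicalSpace (AffinePoints k E) :=
  TopologicalSpace.induced (fun x => (AffinePoints.eval x).toPrimeSpectrum) inferInstance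

theorem AffinePoints.eval_X {E : Type*} (x : AffinePoints k E) (e : E) :
    x.eval (MvPolynomial.X e) = x e := by
  simp [AffinePoints.eval]

theorem AffinePoints.isClosed_iff {E : Type*} {C : Set (AffinePoints k E)} :
    IsClosed C ↔ ∃ s : Set (MvPolynomial E k), C = {x | ∀ f ∈ s, x.eval f = 0} :=
  isClosed_induced_toPrimeSpectrum_iff AffinePoints.eval

theorem AffinePoints.topologicalKrullDim_le (E : Type*) [Finite E] :
    topologicalKrullDim (AffinePoints k E) ≤ Nat.card E := by
  have h : Topology.IsInducing
    (fun x : AffinePoints k E => (AffinePoints.eval x).toPrimeSpectrum) := ⟨rfl⟩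
  refine h.topologicalKrullDim_le.trans ?_
  rw [PrimeSpectrum.topologicalKrullDim_eq_ringKrullDim,
    MvPolynomial.ringKrullDim_of_isNoetherianRing, ringKrullDim_eq_zero_of_field, zero_add]

instance AffinePoints.instIrreducibleSpace [Infinite k] (E : Type*) :
    IrreducibleSpace (AffinePoints k E) where
  toNonempty := ⟨fun _ => 0⟩
  isPreirreducible_univ := by
    rw [isPreirreducible_iff_isClosed_union_isClosed]
    intro Z₁ Z₂ h₁ h₂ h
    obtain ⟨s₁, rfl⟩ := AffinePoints.isClosed_iff.1 h₁
    obtain ⟨s₂, rfl⟩ := AffinePoints.isClosed_iff.1 h₂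
    by_contra! hc
    simp only [Set.univ_subset_iff, Set.eq_univ_iff_forall, Set.mem_ofPred_eq, not_forall] at hc
    obtain ⟨⟨x, f, hf, hfx⟩, ⟨y, g, hg, hgy⟩⟩ := hc
    have hfg : f * g ≠ 0 := by
      apply mul_ne_zero <;> rintro rfl <;> simp at hfx hgy
    -- Over an infinite field a polynomial vanishing at every point is zero.
    apply hfg
    apply MvPolynomial.funext
    intro z
    rcases h (Set.mem_univ (z : AffinePoints k E)) with hz | hz
    · have := hz f hf
      simp only [AffinePoints.eval, MvPolynomial.aeval_eq_eval] at this
      rw [map_mul, map_zero]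
      exact mul_eq_zero_of_left this _
    · have := hz g hg
      simp only [AffinePoints.eval, MvPolynomial.aeval_eq_eval] at this
      rw [map_mul, map_zero]
      exact mul_eq_zero_of_right _ this

/-- The functions on `Z` which are quotients of polynomials in the coordinates of `φ`, with nowhere
vanishing denominator. -/
def rationalFunctions {Z E : Type*} (φ : Z → AffinePoints k E) : Subalgebra k (Z → k) where
  carrier := {f | ∃ P Q : MvPolynomial E k,
    (∀ z, (φ z).eval Q ≠ 0) ∧ ∀ z, f z * (φ z).eval Q = (φ z).eval P}
  mul_mem' := by
    rintro f g ⟨P, Q, hQ, h⟩ ⟨P', Q', hQ', h'⟩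
    refine ⟨P * P', Q * Q', fun z => by simp [hQ, hQ'], fun z => ?_⟩
    rw [map_mul, map_mul, ← h, ← h', Pi.mul_apply]
    ring
  add_mem' := by
    rintro f g ⟨P, Q, hQ, h⟩ ⟨P', Q', hQ', h'⟩
    refine ⟨P * Q' + P' * Q, Q * Q', fun z => by simp [hQ, hQ'], fun z => ?_⟩
    rw [map_add, map_mul, map_mul, map_mul, ← h, ← h', Pi.add_apply]
    ring
  algebraMap_mem' c := ⟨MvPolynomial.C c, 1, fun z => by simp, fun z => by
    simp [AffinePoints.eval]⟩

theorem coordinate_mem_rationalFunctions {Z E : Type*} (φ : Z → AffinePoints k E) (e : E) :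
    (fun z => φ z e) ∈ rationalFunctions φ :=
  ⟨MvPolynomial.X e, 1, fun z => by simp, fun z => by rw [AffinePoints.eval_X]; simp⟩

theorem const_mem_rationalFunctions {Z E : Type*} (φ : Z → AffinePoints k E) (c : k) :
    (fun _ => c) ∈ rationalFunctions φ :=
  (rationalFunctions φ).algebraMap_mem c

theorem inv_mem_rationalFunctions {Z E : Type*} {φ : Z → AffinePoints k E} {f : Z → k}
    (hf : f ∈ rationalFunctions φ) (h0 : ∀ z, f z ≠ 0) :
    (fun z => (f z)⁻¹) ∈ rationalFunctions φ := by
  obtain ⟨P, Q, hQ, h⟩ := hf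
  refine ⟨Q, P, fun z => ?_, fun z => ?_⟩
  · rw [← h]
    exact mul_ne_zero (h0 z) (hQ z)
  · rw [← h, inv_mul_cancel_left₀ (h0 z)]

/-- If all regular functions on `X` are rational in the coordinates of `φ`, then the topology
induced by `φ` is finer than the Zariski topology of `X`. -/
theorem induced_le_of_rationalFunctions {Z E A : Type*} [CommRing A] [Algebra k A]
    (ev : Z → A →ₐ[k] k) (φ : Z → AffinePoints k E)
    (h : ∀ a, (fun z => ev z a) ∈ rationalFunctions φ) :
    TopologicalSpace.induced φ inferInstance ≤
      TopologicalSpace.induced (fun z => (ev z).toPrimeSpectrum) inferInstance := by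
  intro U hU
  rw [← @isClosed_compl_iff] at hU ⊢
  obtain ⟨s, hs⟩ := (isClosed_induced_toPrimeSpectrum_iff ev).1 hU
  rw [hs]
  -- The denominators vanish nowhere, so the numerators cut out the same closed set.
  choose P Q hQ hPQ using h
  refine isClosed_induced_iff.2 ⟨{x | ∀ f ∈ P '' s, x.eval f = 0}, AffinePoints.isClosed_iff.2 ⟨_, rfl⟩, ?_⟩
  ext z
  simp only [Set.mem_preimage, Set.mem_ofPred_eq, Set.forall_mem_image, ← hPQ, mul_eq_zero, hQ,
    or_false]

end Zariski

/-! ### Krull dimension and irreducible closed subsets -/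

section KrullDim

open TopologicalSpace Topology

variable {X : Type*} [TopologicalSpace X]

theorem isIrreducible_preimage_val_of_subset {Z W : Set X} (hW : IsIrreducible W) (h : W ⊆ Z) :
    IsIrreducible (Subtype.val ⁻¹' W : Set Z) := by
  refine ⟨?_, ?_⟩
  · obtain ⟨x, hx⟩ := hW.1
    exact ⟨⟨x, h hx⟩, hx⟩
  · rintro _ _ ⟨U, hU, rfl⟩ ⟨V, hV, rfl⟩ ⟨x, hx, hxU⟩ ⟨y, hy, hyV⟩
    obtain ⟨z, hz, hz'⟩ := hW.2 U V hU hV ⟨x, hx, hxU⟩ ⟨y, hy, hyV⟩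
    exact ⟨⟨z, h hz⟩, hz, hz'⟩

/-- The dimension of a space is bounded by the dimensions of its irreducible closed subsets. -/
theorem topologicalKrullDim_le_of_forall_irreducibleCloseds {d : WithBot ℕ∞}
    (h : ∀ Z : Set X, IsIrreducible Z → IsClosed Z → topologicalKrullDim Z ≤ d) :
    topologicalKrullDim X ≤ d := by
  -- The dimension is the supremum of the heights of the irreducible closed sets `Z`, and a chain
  -- ending at `Z` is a chain in the subspace `Z`.
  rw [topologicalKrullDim, Order.krullDim_eq_iSup_height, iSup_le_iff]
  intro Z
  rw [Order.height_eq_krullDim_Iic]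
  refine le_trans ?_ (h Z Z.isIrreducible Z.isClosed)
  refine Order.krullDim_le_of_strictMono (fun W => ⟨Subtype.val ⁻¹' (W.1 : Set X),
    isIrreducible_preimage_val_of_subset W.1.isIrreducible W.2,
    W.1.isClosed.preimage continuous_subtype_val⟩) ?_
  refine Monotone.strictMono_of_injective (fun W W' hW => ?_) (fun W W' hW => ?_)
  · exact fun x hx => (show (W.1 : Set X) ⊆ (W'.1 : Set X) from hW) hx
  · apply Subtype.ext
    apply SetLike.coe_injective
    have h1 : (Subtype.val ⁻¹' (W.1 : Set X) : Set Z) = Subtype.val ⁻¹' (W'.1 : Set X) :=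
      congrArg (fun V : IrreducibleCloseds Z => (V : Set Z)) hW
    have h2 : (W.1 : Set X) ⊆ (Z : Set X) := W.2
    have h3 : (W'.1 : Set X) ⊆ (Z : Set X) := W'.2
    ext x
    constructor
    · exact fun hx => (Set.ext_iff.1 h1 ⟨x, h2 hx⟩).1 hx
    · exact fun hx => (Set.ext_iff.1 h1 ⟨x, h3 hx⟩).2 hx

/-- A continuous function with finitely many values in a `T1` space is constant on an irreducible
set. -/
theorem IsIrreducible.exists_eq_of_finite {Z : Set X} (hZ : IsIrreducible Z) {α : Type*}
    (f : X → α) (hf : ∀ c, IsClosed (f ⁻¹' {c})) {s : Set α} (hs : s.Finite)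
    (h : ∀ x ∈ Z, f x ∈ s) : ∃ c ∈ s, ∀ x ∈ Z, f x = c := by
  classical
  have := isIrreducible_iff_sUnion_isClosed.1 hZ (hs.toFinset.image fun c => f ⁻¹' {c})
    (by
      intro z hz
      obtain ⟨c, -, rfl⟩ := Finset.mem_image.1 hz
      exact hf c)
    (fun x hx => ⟨_, Finset.mem_coe.2 (Finset.mem_image.2 ⟨f x, hs.mem_toFinset.2 (h x hx), rfl⟩), rfl⟩)
  obtain ⟨z, hz, hZz⟩ := this
  obtain ⟨c, hc, rfl⟩ := Finset.mem_image.1 hz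
  exact ⟨c, hs.mem_toFinset.1 hc, fun x hx => hZz hx⟩

end KrullDim

/-! ### Dimension of the open set where some coordinates are nonzero -/

section AffineOpen

open scoped Topology

variable {k : Type*} [Field k]

theorem eval_mem_rationalFunctions {Z E E' : Type*} {φ : Z → AffinePoints k E}
    {g : Z → AffinePoints k E'} (h : ∀ e, (fun z => g z e) ∈ rationalFunctions φ)
    (a : MvPolynomial E' k) : (fun z => (g z).eval a) ∈ rationalFunctions φ := by
  induction a using MvPolynomial.induction_on with
  | C c =>
    have := const_mem_rationalFunctions φ c
    simpa [AffinePoints.eval] using this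
  | add p q hp hq =>
    simp only [map_add]
    exact add_mem hp hq
  | mul_X p e hp =>
    simp only [map_mul, AffinePoints.eval_X]
    exact mul_mem hp (h e)

theorem AffinePoints.continuous_of_rationalFunctions {Z E E' : Type*} [TopologicalSpace Z]
    {φ : Z → AffinePoints k E} (hφ : Continuous φ)
    {g : Z → AffinePoints k E'} (h : ∀ e, (fun z => g z e) ∈ rationalFunctions φ) :
    Continuous g := by
  have := induced_le_of_rationalFunctions (fun z => (g z).eval) φ (eval_mem_rationalFunctions h)
  rw [continuous_iff_le_induced] at hφ ⊢
  refine (hφ.trans this).trans_eq ?_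
  rw [AffinePoints.instTopologicalSpace, induced_compose]
  rfl

theorem AffinePoints.isClosed_coordinate_eq {E : Type*} (e : E) (c : k) :
    IsClosed {x : AffinePoints k E | x e = c} := by
  refine AffinePoints.isClosed_iff.2 ⟨{MvPolynomial.X e - MvPolynomial.C c}, ?_⟩
  ext x
  simp [AffinePoints.eval, sub_eq_zero]

/-- The points of the affine space with nonzero coordinates at the places of `s`. -/
def AffinePoints.nonvanishing (k : Type*) [Field k] {E : Type*} (s : Set E) :
    Set (AffinePoints k E) :=
  {x | ∀ e ∈ s, x e ≠ 0}

theorem AffinePoints.isOpen_nonvanishing {E : Type*} [Finite E] (s : Set E) :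
    IsOpen (AffinePoints.nonvanishing k s) := by
  have : AffinePoints.nonvanishing k s = ⋂ e ∈ s, {x | x e = 0}ᶜ := by
    ext x
    simp [AffinePoints.nonvanishing]
  rw [this]
  exact s.toFinite.isOpen_biInter fun e _ => (isClosed_coordinate_eq e 0).isOpen_compl

instance AffinePoints.irreducibleSpace_nonvanishing [Infinite k] {E : Type*} [Finite E]
    (s : Set E) : IrreducibleSpace (AffinePoints.nonvanishing k s) := by
  apply Subtype.irreducibleSpace
  refine ⟨⟨fun _ => 1, fun e _ => one_ne_zero⟩, ?_⟩
  exact (IrreducibleSpace.isIrreducible_univ (AffinePoints k E)).2.open_subset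
    (isOpen_nonvanishing s) (Set.subset_univ _)

/-- The set is a retract of an irreducible space: `r` resets the coordinates in `t` to `1`, a value
that respects the nonvanishing conditions. -/
theorem AffinePoints.isIrreducible_eq_one [Infinite k] {E : Type*} [Finite E] (s t : Set E) :
    IsIrreducible {x : AffinePoints.nonvanishing k s | ∀ e ∈ t, x.1 e = 1} := by
  classical
  let r : AffinePoints.nonvanishing k s → AffinePoints.nonvanishing k s := fun x =>
    ⟨fun e => if e ∈ t then 1 else x.1 e, fun e he => by
      dsimp only
      split_ifs
      · exact one_ne_zero
      · exact x.2 e he⟩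
  have hr : Continuous r := by
    refine Continuous.subtype_mk (continuous_of_rationalFunctions continuous_subtype_val ?_) _
    intro e
    by_cases he : e ∈ t
    · simp only [he, if_true]
      exact const_mem_rationalFunctions _ 1
    · simp only [he, if_false]
      exact coordinate_mem_rationalFunctions _ e
  convert (IrreducibleSpace.isIrreducible_univ (AffinePoints.nonvanishing k s)).image r
    hr.continuousOn using 1
  ext x
  constructor
  · intro hx
    refine ⟨x, Set.mem_univ _, Subtype.ext (funext fun e => ?_)⟩
    change (if e ∈ t then 1 else x.1 e) = x.1 e
    split_ifs with he
    · exact (hx e he).symm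
    · rfl
  · rintro ⟨y, -, rfl⟩ e he
    exact if_pos he

theorem AffinePoints.isClosed_eq_one {E : Type*} (s t : Set E) :
    IsClosed {x : AffinePoints.nonvanishing k s | ∀ e ∈ t, x.1 e = 1} := by
  have : {x : AffinePoints.nonvanishing k s | ∀ e ∈ t, x.1 e = 1} =
      ⋂ e ∈ t, Subtype.val ⁻¹' {x : AffinePoints k E | x e = 1} := by
    ext x
    simp
  rw [this]
  exact isClosed_biInter fun e _ => (isClosed_coordinate_eq e 1).preimage continuous_subtype_val

theorem AffinePoints.le_topologicalKrullDim_nonvanishing [CharZero k] {E : Type*} [Finite E]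
    (s : Set E) : Nat.card E ≤ topologicalKrullDim (AffinePoints.nonvanishing k s) := by
  classical
  let ψ := Finite.equivFin E
  let d := Nat.card E
  -- A chain of length `d` that releases the coordinates one by one, starting from the point with
  -- all coordinates `1`.
  let C : ℕ → TopologicalSpace.IrreducibleCloseds (AffinePoints.nonvanishing k s) := fun i =>
    ⟨{x | ∀ e ∈ {e : E | i ≤ (ψ e : ℕ)}, x.1 e = 1}, isIrreducible_eq_one s _, isClosed_eq_one s _⟩
  have hC : ∀ i : Fin d, C i < C (i + 1) := by
    intro i
    refine lt_of_le_not_ge (fun x hx e he => hx e (Nat.le_of_succ_le he)) fun h => ?_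
    -- The value `2` differs from `1`, and from `0` by characteristic zero.
    let x : AffinePoints.nonvanishing k s :=
      ⟨fun e => if e = ψ.symm i then 2 else 1, fun e _ => by dsimp only; split_ifs <;> simp⟩
    have hx : x ∈ C (i + 1) := by
      intro e he
      refine if_neg ?_
      rintro rfl
      simp at he
    have h1 : x.1 (ψ.symm i) = 1 := h hx (ψ.symm i) (by simp)
    simp [x] at h1
  have := Order.LTSeries.length_le_krullDim
    (⟨d, fun i : Fin (d + 1) => C i, fun i => by simpa using hC i⟩ :
      LTSeries (TopologicalSpace.IrreducibleCloseds (AffinePoints.nonvanishing k s)))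
  exact this

end AffineOpen

/-! ### Coefficients of jets as rational functions -/

section JetCoefficients

variable {k : Type*} [Field k] {m : ℕ}

theorem JetRing.coeff_zero_mul (x y : JetRing k m) :
    (x * y).coeff 0 = x.coeff 0 * y.coeff 0 := by
  rw [JetRing.coeff_mul, Finset.sum_eq_single_of_mem (0, 0) (by simp)]
  rintro ⟨p, q⟩ hpq hne
  simp only [Finset.mem_filter, Finset.mem_univ, true_and, Fin.val_zero, Nat.add_eq_zero_iff,
    Fin.val_eq_zero_iff] at hpq
  exact absurd (Prod.ext hpq.1 hpq.2) hne

theorem JetRing.coeff_one (j : Fin (m + 1)) :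
    (1 : JetRing k m).coeff j = if j = 0 then 1 else 0 := by
  simpa using JetRing.coeff_algebraMap (A := k) (m := m) (1 : k) j

theorem jetEquiv_symm_jetCoord {R : Type*} [CommRing R] [Algebra k R] (γ : R →ₐ[k] JetRing k m)
    (r : R) (j : Fin (m + 1)) : (jetEquiv k).symm γ (jetCoord k m r j) = (γ r).coeff j := by
  conv_rhs => rw [← Equiv.apply_symm_apply (jetEquiv k) γ]
  exact (JetRing.coeff_ofCoeff
    (fun j => (jetEquiv k).symm γ (jetCoord k m r j)) j).symm

variable {Z E : Type*} {φ : Z → AffinePoints k E}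

theorem coeff_mul_mem_rationalFunctions {x y : Z → JetRing k m}
    (hx : ∀ l, (fun z => (x z).coeff l) ∈ rationalFunctions φ)
    (hy : ∀ l, (fun z => (y z).coeff l) ∈ rationalFunctions φ) (l : Fin (m + 1)) :
    (fun z => (x z * y z).coeff l) ∈ rationalFunctions φ := by
  simp only [JetRing.coeff_mul]
  rw [← Finset.sum_fn]
  exact sum_mem fun p _ => mul_mem (hx p.1) (hy p.2)

/-- The coefficients of an inverse are computed recursively from `x y = 1`, dividing only by the
constant coefficient of `x`, which never vanishes. -/
theorem coeff_inv_mem_rationalFunctions {x y : Z → JetRing k m}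
    (hx : ∀ l, (fun z => (x z).coeff l) ∈ rationalFunctions φ)
    (hxy : ∀ z, x z * y z = 1) (l : Fin (m + 1)) :
    (fun z => (y z).coeff l) ∈ rationalFunctions φ := by
  have h0 : ∀ z, (x z).coeff 0 ≠ 0 := fun z h => by
    have := congrArg (fun w => JetRing.coeff w 0) (hxy z)
    simp [JetRing.coeff_zero_mul, JetRing.coeff_one, h] at this
  induction l using Fin.strong_induction_on with
  | _ l ih =>
    have key : (fun z => (y z).coeff l) = fun z => ((x z).coeff 0)⁻¹ *
        ((if l = 0 then 1 else 0) -
          ∑ p ∈ ({p : Fin (m + 1) × Fin (m + 1) | (p.1 : ℕ) + p.2 = l} : Finset _).erase (0, l),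
            (x z).coeff p.1 * (y z).coeff p.2) := by
      funext z
      have h := congrArg (fun w => JetRing.coeff w l) (hxy z)
      simp only [JetRing.coeff_mul, JetRing.coeff_one] at h
      rw [← Finset.add_sum_erase (a := (0, l)) _ _ (by simp)] at h
      rw [← h, add_sub_cancel_right, inv_mul_cancel_left₀ (h0 z)]
    rw [key]
    refine mul_mem (inv_mem_rationalFunctions (hx 0) h0)
      (sub_mem (const_mem_rationalFunctions φ _) ?_)
    rw [← Finset.sum_fn]
    refine sum_mem fun p hp => mul_mem (hx p.1) (ih p.2 ?_)
    simp only [Finset.mem_erase, Finset.mem_filter, Finset.mem_univ, true_and] at hp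
    obtain ⟨hne, hp⟩ := hp
    rw [Fin.lt_def]
    by_contra! hc
    exact hne (Prod.ext (Fin.ext (by rw [Fin.val_zero]; omega)) (Fin.ext (by dsimp only; omega)))

/-- The regular functions on the jet scheme of a torus are rational in the coefficients of the jets
of a basis of characters. -/
theorem jet_mem_rationalFunctions {M ι : Type*} [AddCommGroup M] (b : Module.Basis ι ℤ M)
    (g : Z → JetPoint k m (AddMonoidAlgebra k M))
    (h : ∀ i l, (fun z => ((g z).hom (chi k (b i))).coeff l) ∈ rationalFunctions φ)
    (f : JetAlgebra k m (AddMonoidAlgebra k M)) :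
    (fun z => (jetEquiv k).symm (g z).hom f) ∈ rationalFunctions φ := by
  -- Characters are obtained from the basis by products and inverses.
  have hchi : ∀ u l, (fun z => ((g z).hom (chi k u)).coeff l) ∈ rationalFunctions φ := by
    intro u
    have hu : u ∈ AddSubgroup.closure (Set.range b) := by
      rw [← Submodule.span_int_eq_addSubgroupClosure, b.span_eq]
      trivial
    induction hu using AddSubgroup.closure_induction with
    | mem u hu =>
      obtain ⟨i, rfl⟩ := hu
      exact h i
    | zero =>
      intro l
      simp only [chi_zero, map_one, JetRing.coeff_one]
      exact const_mem_rationalFunctions φ _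
    | add u v _ _ hu hv =>
      simp only [chi_add, map_mul]
      exact coeff_mul_mem_rationalFunctions hu hv
    | neg u _ hu =>
      refine coeff_inv_mem_rationalFunctions hu fun z => ?_
      rw [← map_mul, ← chi_add, add_neg_cancel, chi_zero, map_one]
  have hcoord : ∀ r l, (fun z => ((g z).hom r).coeff l) ∈ rationalFunctions φ := by
    intro r
    induction r using AddMonoidAlgebra.induction_linear with
    | zero =>
      intro l
      have : (0 : JetRing k m).coeff l = 0 := by
        simpa using JetRing.coeff_add (0 : JetRing k m) 0 l
      simp only [map_zero, this]
      exact const_mem_rationalFunctions φ _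
    | add r s hr hs =>
      intro l
      simp only [map_add, JetRing.coeff_add]
      exact add_mem (hr l) (hs l)
    | single u c =>
      have : AddMonoidAlgebra.single u c = algebraMap k (AddMonoidAlgebra k M) c * chi k u := by
        rw [chi, ← Algebra.smul_def, AddMonoidAlgebra.smul_single, smul_eq_mul, mul_one]
      rw [this]
      simp only [map_mul, AlgHom.commutes]
      refine coeff_mul_mem_rationalFunctions (fun l => ?_) (hchi u)
      simp only [JetRing.coeff_algebraMap]
      exact const_mem_rationalFunctions φ _
  obtain ⟨p, rfl⟩ := Ideal.Quotient.mk_surjective f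
  induction p using MvPolynomial.induction_on with
  | C c =>
    have : ∀ z, (jetEquiv k).symm (g z).hom (Ideal.Quotient.mk (jetIdeal k m (AddMonoidAlgebra k M))
        (MvPolynomial.C c)) = c := fun z => ((jetEquiv k).symm (g z).hom).commutes c
    simp only [this]
    exact const_mem_rationalFunctions φ c
  | add p q hp hq =>
    simp only [map_add]
    exact add_mem hp hq
  | mul_X p e hp =>
    simp only [map_mul]
    refine mul_mem hp ?_
    have := hcoord e.1 e.2
    simp only [← jetEquiv_symm_jetCoord] at this
    exact this

theorem JetPoint.isClosed_coeff_eq {R : Type*} [CommRing R] [Algebra k R] (r : R)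
    (l : Fin (m + 1)) (c : k) : IsClosed {γ : JetPoint k m R | (γ.hom r).coeff l = c} := by
  refine (isClosed_induced_toPrimeSpectrum_iff (fun γ : JetPoint k m R =>
    (jetEquiv k).symm γ.hom)).2 ⟨{jetCoord k m r l - algebraMap k _ c}, ?_⟩
  ext γ
  simp only [Set.mem_singleton_iff, forall_eq, Set.mem_ofPred_eq, map_sub, AlgHom.commutes,
    jetEquiv_symm_jetCoord, sub_eq_zero]
  rfl

end JetCoefficients

/-! ### The `t`-adic filtration and the stabilizer congruences -/

section JetFiltration

namespace JetRing

variable {k : Type*} [Field k] {m : ℕ}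

/-- The constant coefficient of an element of `k[t]/(t^(m+1))`. -/
def constCoeff : JetRing k m →+* k where
  toFun x := x.coeff 0
  map_one' := by simp [JetRing.coeff_one]
  map_mul' := JetRing.coeff_zero_mul
  map_zero' := by simpa using JetRing.coeff_add (0 : JetRing k m) 0 0
  map_add' x y := JetRing.coeff_add x y 0

/-- The coefficient of `t^j` as an additive map. -/
def coeffHom (j : Fin (m + 1)) : JetRing k m →+ k where
  toFun x := x.coeff j
  map_zero' := by simpa using JetRing.coeff_add (0 : JetRing k m) 0 j
  map_add' x y := JetRing.coeff_add x y j

theorem coeff_zero (j : Fin (m + 1)) : (0 : JetRing k m).coeff j = 0 := (coeffHom j).map_zero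

theorem coeff_sub (x y : JetRing k m) (j : Fin (m + 1)) :
    (x - y).coeff j = x.coeff j - y.coeff j := (coeffHom j).map_sub x y

/-- The ideal generated by `t^l` in `k[t]/(t^(m+1))`. -/
def orderIdeal (k : Type*) [Field k] (m l : ℕ) : Ideal (JetRing k m) where
  carrier := {x | ∀ j : Fin (m + 1), (j : ℕ) < l → x.coeff j = 0}
  zero_mem' j _ := coeff_zero j
  add_mem' hx hy j hj := by rw [coeff_add, hx j hj, hy j hj, add_zero]
  smul_mem' c x hx j hj := by
    rw [smul_eq_mul, coeff_mul]
    refine Finset.sum_eq_zero fun p hp => ?_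
    simp only [Finset.mem_filter, Finset.mem_univ, true_and] at hp
    rw [hx p.2 (by omega), mul_zero]

theorem mem_orderIdeal {l : ℕ} {x : JetRing k m} :
    x ∈ orderIdeal k m l ↔ ∀ j : Fin (m + 1), (j : ℕ) < l → x.coeff j = 0 := Iff.rfl

theorem orderIdeal_anti {l l' : ℕ} (h : l ≤ l') : orderIdeal k m l' ≤ orderIdeal k m l :=
  fun _ hx j hj => hx j (hj.trans_le h)

theorem coeff_truncHom (f : PowerSeries k) (j : Fin (m + 1)) :
    (truncHom k m f).coeff j = PowerSeries.coeff (j : ℕ) f :=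
  coeff_ofCoeff (fun j : Fin (m + 1) => PowerSeries.coeff (j : ℕ) f) j

theorem truncHom_surjective : Function.Surjective (truncHom k m) := by
  intro x
  refine ⟨PowerSeries.mk fun j => if h : j < m + 1 then x.coeff ⟨j, h⟩ else 0, ?_⟩
  refine JetRing.ext fun j => ?_
  rw [coeff_truncHom, PowerSeries.coeff_mk, dif_pos j.2]

theorem truncHom_mem_orderIdeal {l : ℕ} (hl : l ≤ m + 1) {f : PowerSeries k} :
    truncHom k m f ∈ orderIdeal k m l ↔ (l : ℕ∞) ≤ f.order := by
  rw [mem_orderIdeal]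
  simp only [coeff_truncHom]
  constructor
  · intro h
    exact PowerSeries.nat_le_order _ _ fun j hj => h ⟨j, by omega⟩ hj
  · intro h j hj
    exact PowerSeries.coeff_of_lt_order _ (lt_of_lt_of_le (by exact_mod_cast hj) h)

theorem orderIdeal_eq_bot : orderIdeal k m (m + 1) = ⊥ := by
  refine (Submodule.eq_bot_iff _).2 fun x hx => JetRing.ext fun j => ?_
  rw [hx j j.2, coeff_zero]

/-- Orders add in `k⟦t⟧`: a lift of `x` times `f` has order at least `m + 1` exactly when the lift
has order at least `m + 1 - e`. -/
theorem mul_truncHom_eq_zero_iff {x : JetRing k m} {f : PowerSeries k} {e : ℕ}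
    (hf : f.order = e) : x * truncHom k m f = 0 ↔ x ∈ orderIdeal k m (m + 1 - e) := by
  obtain ⟨p, rfl⟩ := truncHom_surjective x
  rw [← map_mul, ← Ideal.mem_bot, ← orderIdeal_eq_bot, truncHom_mem_orderIdeal le_rfl,
    truncHom_mem_orderIdeal (Nat.sub_le _ _), PowerSeries.order_mul, hf, ENat.natCast_sub,
    tsub_le_iff_right]

theorem isUnit_of_constCoeff_ne_zero {x : JetRing k m} (hx : x.coeff 0 ≠ 0) : IsUnit x := by
  obtain ⟨p, rfl⟩ := truncHom_surjective x
  refine IsUnit.map (truncHom k m) (PowerSeries.isUnit_iff_constantCoeff.2 ?_)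
  rw [coeff_truncHom] at hx
  exact isUnit_iff_ne_zero.2 (by simpa using hx)

/-- In characteristic zero, roots of elements close to `1` are close to a constant. -/
theorem sub_algebraMap_mem_of_pow [CharZero k] {x : JetRing k m} {N l : ℕ} (hN : N ≠ 0)
    (hl : l ≠ 0) (h : x ^ N - 1 ∈ orderIdeal k m l) :
    (x.coeff 0) ^ N = 1 ∧ x - algebraMap k _ (x.coeff 0) ∈ orderIdeal k m l := by
  have h1 : (x.coeff 0) ^ N = 1 := by
    have h2 := h 0 (Nat.pos_of_ne_zero hl)
    rw [coeff_sub, sub_eq_zero] at h2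
    exact (map_pow constCoeff x N).symm.trans (h2.trans (map_one constCoeff))
  refine ⟨h1, ?_⟩
  have hc : constCoeff (algebraMap k (JetRing k m) (x.coeff 0)) = x.coeff 0 := by
    refine (coeff_algebraMap _ _).trans ?_
    simp
  -- With `c` the constant coefficient, `x^N - 1 = x^N - c^N` is `x - c` times this sum, whose
  -- constant coefficient `N c^(N-1)` is nonzero in characteristic zero.
  have hu : IsUnit (∑ i ∈ Finset.range N, x ^ i *
      (algebraMap k (JetRing k m) (x.coeff 0)) ^ (N - 1 - i)) := by
    refine isUnit_of_constCoeff_ne_zero ?_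
    change constCoeff _ ≠ 0
    have hx : constCoeff x = x.coeff 0 := rfl
    simp only [map_sum, map_mul, map_pow, hc, hx]
    have : ∀ i ∈ Finset.range N, x.coeff 0 ^ i * x.coeff 0 ^ (N - 1 - i) = x.coeff 0 ^ (N - 1) := by
      intro i hi
      have := Finset.mem_range.1 hi
      rw [← pow_add]
      congr 1
      omega
    rw [Finset.sum_congr rfl this, Finset.sum_const, Finset.card_range, nsmul_eq_mul]
    refine mul_ne_zero (Nat.cast_ne_zero.2 hN) (pow_ne_zero _ fun h0 => ?_)
    rw [h0, zero_pow hN] at h1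
    exact zero_ne_one h1
  rw [← Ideal.unit_mul_mem_iff_mem _ hu, geom_sum₂_mul, ← map_pow, h1, map_one]
  exact h

end JetRing

/-- The characters on which a jet of the torus is congruent to `1` modulo an ideal. -/
def JetPoint.congruentOne {k : Type*} [Field k] {m : ℕ} {M : Type*} [AddCommGroup M]
    (g : JetPoint k m (AddMonoidAlgebra k M)) (I : Ideal (JetRing k m)) : Submodule ℤ M :=
  AddSubgroup.toIntSubmodule
    { carrier := {u | g.hom (chi k u) - 1 ∈ I}
      zero_mem' := by simp [chi_zero]
      add_mem' := fun {u v} hu hv => by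
        have : g.hom (chi k (u + v)) - 1 =
            g.hom (chi k u) * (g.hom (chi k v) - 1) + (g.hom (chi k u) - 1) := by
          rw [chi_add, map_mul]; ring
        rw [Set.mem_ofPred_eq, this]
        exact add_mem (I.mul_mem_left _ hv) hu
      neg_mem' := fun {u} hu => by
        have h1 : g.hom (chi k (-u)) * g.hom (chi k u) = 1 := by
          rw [← map_mul, ← chi_add, neg_add_cancel, chi_zero, map_one]
        have : g.hom (chi k (-u)) - 1 = -g.hom (chi k (-u)) * (g.hom (chi k u) - 1) := by
          linear_combination h1
        rw [Set.mem_ofPred_eq, this]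
        exact I.mul_mem_left _ hu }

theorem JetPoint.mem_congruentOne {k : Type*} [Field k] {m : ℕ} {M : Type*} [AddCommGroup M]
    {g : JetPoint k m (AddMonoidAlgebra k M)} {I : Ideal (JetRing k m)} {u : M} :
    u ∈ g.congruentOne I ↔ g.hom (chi k u) - 1 ∈ I := Iff.rfl

/-- Fixing `γ` means `(g(χ^u) - 1) γ(χ^u) = 0` for all `u`. The order of `γ(χ^u)` turns this into a
congruence; weights above `m` impose nothing, as `γ(χ^u) = 0` there. -/
theorem mem_stabilizer_jetOrbit_iff {k : Type*} [Field k] {N : Type*} [AddCommGroup N]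
    {σ : PointedCone ℝ (ℝ ⊗[ℤ] N)} {m : ℕ} {a : N}
    {γ : JetPoint k m (AddMonoidAlgebra k (dualMonoid σ))} (hγ : γ ∈ jetOrbit k σ m a)
    (g : JetPoint k m (AddMonoidAlgebra k (Module.Dual ℤ N))) :
    g ∈ MulAction.stabilizer (JetPoint k m (AddMonoidAlgebra k (Module.Dual ℤ N))) γ ↔
      ∀ u : dualMonoid σ, ((u : Module.Dual ℤ N) a).toNat ≤ m → (u : Module.Dual ℤ N) ∈
        g.congruentOne (JetRing.orderIdeal k m (m + 1 - ((u : Module.Dual ℤ N) a).toNat)) := by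
  obtain ⟨δ, -, rfl, hδ⟩ := hγ
  have h1 : g ∈ MulAction.stabilizer (JetPoint k m (AddMonoidAlgebra k (Module.Dual ℤ N)))
      (δ.toJet m) ↔ ∀ u : dualMonoid σ,
        (g.hom (chi k (u : Module.Dual ℤ N)) - 1) * truncHom k m (δ (chi k u)) = 0 := by
    rw [MulAction.mem_stabilizer_iff]
    have h2 : ∀ u, (δ.toJet m).hom (chi k u) = truncHom k m (δ (chi k u)) := fun _ => rfl
    simp only [sub_mul, one_mul, sub_eq_zero, ← h2, ← JetPoint.smul_chi]
    exact ⟨fun h u => by rw [h], JetPoint.ext_chi⟩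
  rw [h1]
  refine forall_congr' fun u => ?_
  have hu := hδ u
  unfold truncOrd at hu
  by_cases hum : ((u : Module.Dual ℤ N) a).toNat ≤ m
  · have hum' : (((u : Module.Dual ℤ N) a).toNat : ℕ∞) ≤ m := by exact_mod_cast hum
    rw [if_pos hum'] at hu
    have : (δ (chi k u)).order = (((u : Module.Dual ℤ N) a).toNat : ℕ∞) := by
      split_ifs at hu
      · exact hu
      · exact absurd hu (ENat.top_ne_natCast _)
    rw [JetRing.mul_truncHom_eq_zero_iff this, JetPoint.mem_congruentOne]
    exact ⟨fun h _ => h, fun h => h hum⟩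
  · have hum' : ¬ (((u : Module.Dual ℤ N) a).toNat : ℕ∞) ≤ m := by exact_mod_cast hum
    rw [if_neg hum'] at hu
    have : ((m + 1 : ℕ) : ℕ∞) ≤ (δ (chi k u)).order := by
      split_ifs at hu with h
      · rw [hu] at h
        exact absurd h (by simp)
      · rw [not_le] at h
        push_cast
        exact Order.add_one_le_of_lt h
    have h0 : truncHom k m (δ (chi k u)) = 0 := by
      rw [← Ideal.mem_bot, ← JetRing.orderIdeal_eq_bot, JetRing.truncHom_mem_orderIdeal le_rfl]
      exact this
    simp [h0, hum]

end JetFiltration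

/-! ### Dimension of a group of jets given by congruences on a basis -/

section Dimension

variable {k : Type*} [Field k] {m : ℕ} {M : Type*} [AddCommGroup M] {ι : Type*}

theorem Module.Basis.exists_character {G : Type*} [CommGroup G] (b : Module.Basis ι ℤ M)
    (x : ι → G) : ∃ f : M → G, f 0 = 1 ∧ (∀ u v, f (u + v) = f u * f v) ∧ ∀ i, f (b i) = x i :=
  ⟨fun u => (b.constr ℤ (fun i => Additive.ofMul (x i)) u).toMul, by simp, fun u v => by simp,
    fun i => by simp⟩

/-- A jet of the torus can have any invertible values on a basis of characters. -/
theorem JetPoint.exists_eq_on_basis (b : Module.Basis ι ℤ M) (x : ι → JetRing k m)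
    (hx : ∀ i, IsUnit (x i)) :
    ∃ g : JetPoint k m (AddMonoidAlgebra k M), ∀ i, g.hom (chi k (b i)) = x i := by
  obtain ⟨f, h0, hadd, hf⟩ := b.exists_character fun i => (hx i).unit
  refine ⟨⟨ofMonomials (fun u => (f u : JetRing k m)) (by simp [h0]) (by simp [hadd])⟩, ?_⟩
  intro i
  rw [ofMonomials_chi, hf, IsUnit.unit_spec]

/-- The pairs of a basis vector and a coefficient that are unconstrained in the stabilizer of a
jet, when the basis vectors have the weights `w`. -/
abbrev FreeCoefficient (w : ι → ℕ) (m : ℕ) : Type _ :=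
  {p : ι × Fin (m + 1) // m + 1 ≤ (p.2 : ℕ) + w p.1}

/-- For each `i` the free exponents are the last `min (w i) (m + 1)` of `0, …, m`. -/
theorem card_freeCoefficient [Fintype ι] (w : ι → ℕ) (m : ℕ) :
    Nat.card (FreeCoefficient w m) = ∑ i, min (w i) (m + 1) := by
  classical
  rw [Nat.card_eq_fintype_card, Fintype.card_subtype, Finset.card_filter,
    Fintype.sum_prod_type]
  refine Finset.sum_congr rfl fun i _ => ?_
  rw [← Finset.card_filter, ← Finset.card_map Fin.valEmbedding,
    show min (w i) (m + 1) = (Finset.Ico (m + 1 - min (w i) (m + 1)) (m + 1)).card by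
      rw [Nat.card_Ico]; omega]
  congr 1
  ext j
  simp only [Finset.mem_map, Finset.mem_filter, Finset.mem_univ, true_and, Fin.valEmbedding_apply,
    Finset.mem_Ico]
  constructor
  · rintro ⟨l, hl, rfl⟩
    have := l.2
    omega
  · intro h
    exact ⟨⟨j, h.2⟩, by dsimp only; omega, rfl⟩

/-- The free coefficients of a jet of the torus. -/
def freeCoefficients (b : Module.Basis ι ℤ M) (w : ι → ℕ)
    (g : JetPoint k m (AddMonoidAlgebra k M)) : AffinePoints k (FreeCoefficient w m) :=
  fun e => (g.hom (chi k (b e.1.1))).coeff e.1.2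

theorem continuous_freeCoefficients (b : Module.Basis ι ℤ M) (w : ι → ℕ) :
    Continuous (freeCoefficients (k := k) (m := m) b w) := by
  refine ⟨fun U hU => ?_⟩
  rw [← isClosed_compl_iff] at hU ⊢
  obtain ⟨s, hs⟩ := AffinePoints.isClosed_iff.1 hU
  rw [← Set.preimage_compl, hs]
  refine (isClosed_induced_toPrimeSpectrum_iff
    (fun γ : JetPoint k m (AddMonoidAlgebra k M) => (jetEquiv k).symm γ.hom)).2
    ⟨(MvPolynomial.aeval fun e : FreeCoefficient w m =>
      jetCoord k m (chi k (b e.1.1)) e.1.2) '' s, ?_⟩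
  ext g
  simp only [Set.forall_mem_image, Set.mem_preimage, Set.mem_ofPred_eq]
  refine forall₂_congr fun f _ => ?_
  rw [← AlgHom.comp_apply, MvPolynomial.comp_aeval]
  simp only [jetEquiv_symm_jetCoord]
  rfl

/-- On an irreducible closed subset the non-free coefficients are constant, so the free ones embed
it topologically into an affine space. -/
theorem topologicalKrullDim_le_freeCoefficient [CharZero k] [Finite ι] (b : Module.Basis ι ℤ M)
    (w N : ι → ℕ) (hN : ∀ i, N i ≠ 0) (H : Set (JetPoint k m (AddMonoidAlgebra k M)))
    (hH : ∀ g ∈ H, ∀ i, w i ≤ m → N i • b i ∈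
      g.congruentOne (JetRing.orderIdeal k m (m + 1 - w i))) :
    topologicalKrullDim H ≤ Nat.card (FreeCoefficient w m) := by
  classical
  refine topologicalKrullDim_le_of_forall_irreducibleCloseds fun Z hZ _ => ?_
  have hval : ∀ i, w i ≤ m → ∀ g ∈ H, (g.hom (chi k (b i))).coeff 0 ^ N i = 1 ∧
      g.hom (chi k (b i)) - algebraMap k _ ((g.hom (chi k (b i))).coeff 0) ∈
        JetRing.orderIdeal k m (m + 1 - w i) := by
    intro i hi g hg
    refine JetRing.sub_algebraMap_mem_of_pow (hN i) (by omega) ?_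
    have := hH g hg i hi
    rw [JetPoint.mem_congruentOne] at this
    have hpow : ∀ n : ℕ, chi k (n • b i) = chi k (b i) ^ n := by
      intro n
      induction n with
      | zero => simp [chi_zero]
      | succ n ih => rw [succ_nsmul, chi_add, ih, pow_succ]
    rwa [hpow, map_pow] at this
  -- There are only finitely many `N i`-th roots of unity, and irreducibility forces a single one on
  -- `Z`.
  have hconst : ∀ i, w i ≤ m → ∃ c : k, ∀ g ∈ Z, (g.1.hom (chi k (b i))).coeff 0 = c := by
    intro i hi
    have hfin : {c : k | c ^ N i = 1}.Finite := by
      refine (Polynomial.nthRootsFinset (N i) (1 : k)).finite_toSet.subset fun c hc => ?_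
      exact (Polynomial.mem_nthRootsFinset (Nat.pos_of_ne_zero (hN i)) 1).2 hc
    obtain ⟨c, -, hc⟩ := hZ.exists_eq_of_finite
      (fun g : H => (g.1.hom (chi k (b i))).coeff 0)
      (fun c => (JetPoint.isClosed_coeff_eq (chi k (b i)) 0 c).preimage continuous_subtype_val)
      hfin (fun g _ => (hval i hi g.1 g.2).1)
    exact ⟨c, hc⟩
  let φ : Z → AffinePoints k (FreeCoefficient w m) := fun g => freeCoefficients b w g.1.1
  have hφ : Continuous φ :=
    (continuous_freeCoefficients b w).comp (continuous_subtype_val.comp continuous_subtype_val)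
  have hrat := jet_mem_rationalFunctions (φ := φ) b (fun g : Z => g.1.1) (fun i l => by
    by_cases he : m + 1 ≤ (l : ℕ) + w i
    · exact coordinate_mem_rationalFunctions φ ⟨(i, l), he⟩
    · obtain ⟨c, hc⟩ := hconst i (by omega)
      have : (fun g : Z => (g.1.1.hom (chi k (b i))).coeff l) =
          fun _ => if l = 0 then c else 0 := by
        funext g
        have h := (hval i (by omega) g.1.1 g.1.2).2 l (by omega)
        rw [JetRing.coeff_sub, sub_eq_zero, JetRing.coeff_algebraMap, hc g.1 g.2] at h
        exact h
      rw [this]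
      exact const_mem_rationalFunctions φ _)
  have hind : Topology.IsInducing φ := by
    refine ⟨le_antisymm (continuous_iff_le_induced.1 hφ) ?_⟩
    refine (induced_le_of_rationalFunctions _ φ hrat).trans_eq ?_
    simp only [instTopologicalSpaceSubtype, JetPoint.instTopologicalSpace, induced_compose]
    rfl
  exact hind.topologicalKrullDim_le.trans (AffinePoints.topologicalKrullDim_le _)

/-- An open subset of affine space embeds into `H`: prescribe the free coefficients arbitrarily, up
to invertibility, and take all others as in the unit jet. -/
theorem freeCoefficient_le_topologicalKrullDim [CharZero k] [Finite ι] (b : Module.Basis ι ℤ M)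
    (w : ι → ℕ) (H : Set (JetPoint k m (AddMonoidAlgebra k M)))
    (hH : ∀ g : JetPoint k m (AddMonoidAlgebra k M), (∀ i, w i ≤ m → b i ∈
      g.congruentOne (JetRing.orderIdeal k m (m + 1 - w i))) → g ∈ H) :
    Nat.card (FreeCoefficient w m) ≤ topologicalKrullDim H := by
  classical
  -- A constant coefficient is free only if `w i ≥ m + 1`; it must then be nonzero to give a unit.
  let s : Set (FreeCoefficient w m) := {e | e.1.2 = 0}
  let x : AffinePoints.nonvanishing k s → ι → JetRing k m := fun z i =>
    JetRing.ofCoeff fun l => if h : m + 1 ≤ (l : ℕ) + w i then z.1 ⟨(i, l), h⟩ else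
      if l = 0 then 1 else 0
  have hx : ∀ z i, IsUnit (x z i) := by
    intro z i
    refine JetRing.isUnit_of_constCoeff_ne_zero ?_
    rw [JetRing.coeff_ofCoeff]
    split_ifs with h h0
    · exact z.2 ⟨(i, 0), h⟩ rfl
    · exact one_ne_zero
    · exact absurd rfl h0
  choose g hgb using fun z => JetPoint.exists_eq_on_basis b (x z) (hx z)
  have hgH : ∀ z, g z ∈ H := by
    refine fun z => hH _ fun i _ => ?_
    rw [JetPoint.mem_congruentOne, hgb]
    intro l hl
    rw [JetRing.coeff_sub, JetRing.coeff_ofCoeff, dif_neg (by omega), JetRing.coeff_one, sub_self]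
  have hφg : ∀ z, freeCoefficients b w (g z) = z.1 := by
    intro z
    funext e
    rw [freeCoefficients, hgb, JetRing.coeff_ofCoeff, dif_pos e.2]
  have hrat := jet_mem_rationalFunctions (φ := fun z : AffinePoints.nonvanishing k s => z.1) b g
    (fun i l => by
      simp only [hgb]
      by_cases he : m + 1 ≤ (l : ℕ) + w i
      · simp only [x, JetRing.coeff_ofCoeff, dif_pos he]
        exact coordinate_mem_rationalFunctions
          (fun z : AffinePoints.nonvanishing k s => z.1) ⟨(i, l), he⟩
      · simp only [x, JetRing.coeff_ofCoeff, dif_neg he]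
        exact const_mem_rationalFunctions _ _)
  have hgc : Continuous g := by
    rw [continuous_iff_le_induced]
    refine (induced_le_of_rationalFunctions _ _ hrat).trans_eq ?_
    simp only [JetPoint.instTopologicalSpace, induced_compose]
    rfl
  -- Reading off the free coefficients is a continuous left inverse of `g`.
  have hind : Topology.IsInducing (Set.codRestrict g H hgH) := by
    refine Topology.IsInducing.of_comp (hgc.subtype_mk _)
      ((continuous_freeCoefficients b w).comp continuous_subtype_val) ?_
    have : freeCoefficients b w ∘ Subtype.val ∘ Set.codRestrict g H hgH = Subtype.val :=
      funext hφg
    rw [Function.comp_assoc, this]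
    exact Topology.IsInducing.subtypeVal
  exact (AffinePoints.le_topologicalKrullDim_nonvanishing s).trans hind.topologicalKrullDim_le

end Dimension

/-! ### Saturated filtrations, adapted bases and determinants -/

section Lattice

/-- The elements with a nonzero multiple in `P`. -/
def Submodule.saturation {M : Type*} [AddCommGroup M] (P : Submodule ℤ M) : Submodule ℤ M where
  carrier := {u | ∃ c : ℤ, c ≠ 0 ∧ c • u ∈ P}
  zero_mem' := ⟨1, one_ne_zero, by simp⟩
  add_mem' := by
    rintro u v ⟨c, hc, hu⟩ ⟨d, hd, hv⟩
    refine ⟨c * d, mul_ne_zero hc hd, ?_⟩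
    rw [smul_add]
    refine add_mem ?_ ?_
    · rw [mul_comm, mul_smul]
      exact P.smul_mem d hu
    · rw [mul_smul]
      exact P.smul_mem c hv
  smul_mem' := by
    rintro n u ⟨c, hc, hu⟩
    refine ⟨c, hc, ?_⟩
    rw [smul_comm]
    exact P.smul_mem n hu

theorem Submodule.le_saturation {M : Type*} [AddCommGroup M] (P : Submodule ℤ M) :
    P ≤ P.saturation :=
  fun u hu => ⟨1, one_ne_zero, by simpa using hu⟩

theorem Submodule.saturation_mono {M : Type*} [AddCommGroup M] {P Q : Submodule ℤ M}
    (h : P ≤ Q) : P.saturation ≤ Q.saturation :=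
  fun _ ⟨c, hc, hu⟩ => ⟨c, hc, h hu⟩

theorem Submodule.mem_saturation_of_smul_mem {M : Type*} [AddCommGroup M] {P : Submodule ℤ M}
    {c : ℤ} (hc : c ≠ 0) {u : M} (h : c • u ∈ P.saturation) : u ∈ P.saturation := by
  obtain ⟨d, hd, hu⟩ := h
  exact ⟨d * c, mul_ne_zero hd hc, by rwa [mul_smul]⟩

/-- A filtration of a lattice by saturated sublattices has an adapted basis. -/
theorem exists_adapted_basis (J : ℕ) : ∀ {M : Type*} [AddCommGroup M] [Module.Free ℤ M]
    [Module.Finite ℤ M] (F : ℕ → Submodule ℤ M), Monotone F →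
    (∀ j (c : ℤ) u, c ≠ 0 → c • u ∈ F j → u ∈ F j) → F J = ⊤ →
    ∃ (ι : Type) (_ : Fintype ι) (b : Module.Basis ι ℤ M) (w : ι → ℕ),
      (∀ i, w i ≤ J) ∧ ∀ j, F j = Submodule.span ℤ (b '' {i | w i ≤ j}) := by
  induction J with
  | zero =>
    intro M _ _ _ F hF _ hJ
    refine ⟨_, inferInstance, Module.finBasis ℤ M, fun _ => 0, fun _ => le_rfl, fun j => ?_⟩
    rw [eq_top_iff.2 (hJ.ge.trans (hF (Nat.zero_le j)))]
    simp [(Module.finBasis ℤ M).span_eq]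
  | succ J ih =>
    intro M _ _ _ F hF hsat hJ
    obtain ⟨ι, hι, b, w, hw, hb⟩ := ih (fun j => (F j).comap (F J).subtype)
      (fun i j hij => Submodule.comap_mono (hF hij))
      (fun j c u hc hu => hsat j c u hc hu) (by simp)
    -- Saturation makes the quotient free, so a basis of `F J` extends to `M`; the added vectors get
    -- weight `J + 1`.
    have : Module.IsTorsionFree ℤ (M ⧸ F J) := by
      rw [Module.isTorsionFree_iff_smul_eq_zero]
      intro c x hx
      obtain ⟨u, rfl⟩ := Submodule.Quotient.mk_surjective _ x
      rw [← Submodule.Quotient.mk_smul, Submodule.Quotient.mk_eq_zero] at hx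
      rw [Submodule.Quotient.mk_eq_zero]
      by_cases hc : c = 0
      · exact Or.inl hc
      · exact Or.inr (hsat J c u hc hx)
    let bQ := Module.finBasis ℤ (M ⧸ F J)
    let w' : ι ⊕ Fin (Module.finrank ℤ (M ⧸ F J)) → ℕ := Sum.elim w fun _ => J + 1
    refine ⟨_, inferInstance, b.sumQuot bQ, w', ?_, fun j => ?_⟩
    · rintro (i | i)
      · exact (hw i).trans (Nat.le_succ J)
      · exact le_rfl
    · rcases Nat.lt_or_ge J j with h | h
      · rw [eq_top_iff.2 (hJ.ge.trans (hF h))]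
        have : {i | w' i ≤ j} = Set.univ := by
          ext i
          rcases i with i | i
          · simpa [w'] using (hw i).trans h.le
          · simpa [w'] using h
        rw [this, Set.image_univ, Module.Basis.span_eq]
      · have : {i | w' i ≤ j} = Sum.inl '' {i | w i ≤ j} := by
          ext i
          rcases i with i | i
          · simp [w']
          · simp [w']
            omega
        rw [this, Set.image_image]
        simp only [Module.Basis.sumQuot_inl]
        have h2 := congrArg (Submodule.map (F J).subtype) (hb j)
        rw [Submodule.map_comap_eq, Submodule.range_subtype, inf_eq_right.2 (hF h),
          Submodule.map_span, Set.image_image] at h2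
        exact h2

variable {M ι : Type*} [AddCommGroup M] [Fintype ι] [DecidableEq ι]

/-- Some term of the Leibniz expansion is nonzero. -/
theorem exists_perm_repr_ne_zero (b : Module.Basis ι ℤ M) {v : ι → M} (hv : b.det v ≠ 0) :
    ∃ π : Equiv.Perm ι, ∀ i, b.repr (v i) (π i) ≠ 0 := by
  rw [Module.Basis.det_apply, Matrix.det_apply] at hv
  obtain ⟨π, -, hπ⟩ := Finset.exists_ne_zero_of_sum_ne_zero hv
  refine ⟨π, fun i hi => hπ ?_⟩
  rw [Finset.prod_eq_zero (Finset.mem_univ i) hi, smul_zero]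

/-- Exchange: if every basis vector has a multiple in the span of a set, then there is a system of
representatives of these sets with nonzero determinant. -/
theorem exists_det_ne_zero_of_mem_saturation (b : Module.Basis ι ℤ M) (T : ι → Set M)
    (hT : ∀ i, b i ∈ (Submodule.span ℤ (T i)).saturation) :
    ∃ v : ι → M, (∀ i, v i ∈ T i) ∧ b.det v ≠ 0 := by
  -- Basis vectors are replaced one at a time. The determinant as a linear form `f` in slot `i` is
  -- nonzero at `b i`; were it zero on `T i`, it would vanish on a nonzero multiple of `b i`.
  have key : ∀ s : Finset ι, ∃ v : ι → M, (∀ i ∈ s, v i ∈ T i) ∧ (∀ i ∉ s, v i = b i) ∧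
      b.det v ≠ 0 := by
    intro s
    induction s using Finset.induction_on with
    | empty => exact ⟨b, by simp, by simp, by simp [b.det_self]⟩
    | insert i s hi ih =>
      obtain ⟨v, hvT, hvb, hv⟩ := ih
      let f : M →ₗ[ℤ] ℤ := b.det.toMultilinearMap.toLinearMap v i
      have hf : ∀ x, f x = b.det (Function.update v i x) := fun x => rfl
      obtain ⟨u, hu, hfu⟩ : ∃ u ∈ T i, f u ≠ 0 := by
        by_contra! hc
        have hle : Submodule.span ℤ (T i) ≤ LinearMap.ker f := Submodule.span_le.2 hc
        obtain ⟨c, hc, hmem⟩ := hT i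
        have := hle hmem
        rw [LinearMap.mem_ker, map_smul, smul_eq_mul, hf, ← hvb i hi, Function.update_eq_self] at this
        exact mul_ne_zero hc hv this
      refine ⟨Function.update v i u, fun j hj => ?_, fun j hj => ?_, hfu⟩
      · by_cases hji : j = i
        · subst hji
          simpa using hu
        · rw [Function.update_of_ne hji]
          exact hvT j (Finset.mem_of_mem_insert_of_ne hj hji)
      · rw [Finset.mem_insert, not_or] at hj
        rw [Function.update_of_ne hj.1]
        exact hvb j hj.2
  obtain ⟨v, hvT, -, hv⟩ := key Finset.univ
  exact ⟨v, fun i => hvT i (Finset.mem_univ i), hv⟩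

theorem span_tmul_eq_top_iff_det_ne_zero (b : Module.Basis ι ℤ M) (v : ι → M) :
    Submodule.span ℝ (Set.range fun i => (1 : ℝ) ⊗ₜ[ℤ] v i) = ⊤ ↔ b.det v ≠ 0 := by
  have hdet : (b.baseChange ℝ).det (fun i => (1 : ℝ) ⊗ₜ[ℤ] v i) = (b.det v : ℝ) := by
    rw [Module.Basis.det_apply, Module.Basis.det_apply, ← eq_intCast (Int.castRingHom ℝ),
      RingHom.map_det]
    congr 1
    ext i j
    simp [Module.Basis.toMatrix_apply, Module.Basis.baseChange_repr_tmul]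
  rw [← Int.cast_ne_zero (α := ℝ), ← hdet, ← isUnit_iff_ne_zero, ← Module.Basis.is_basis_iff_det]
  refine ⟨fun h => ⟨?_, h⟩, fun h => h.2⟩
  refine linearIndependent_of_top_le_span_of_card_eq_finrank h.ge ?_
  rw [Module.finrank_eq_card_basis (b.baseChange ℝ)]

end Lattice

/-! ### Salient rational cones and their dual semigroups -/

section Cone

/-- Finitely many lattice vectors in an open half space lie in a half space with integral normal
vector. -/
theorem exists_integral_pos_of_real_pos {n : Type*} [Fintype n] (S : Finset (n → ℤ)) (f : n → ℝ)
    (hf : ∀ v ∈ S, 0 < ∑ i, f i * (v i : ℝ)) :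
    ∃ z : n → ℤ, ∀ v ∈ S, 0 < ∑ i, z i * v i := by
  classical
  have hopen : IsOpen {f : n → ℝ | ∀ v ∈ S, 0 < ∑ i, f i * (v i : ℝ)} := by
    have : {f : n → ℝ | ∀ v ∈ S, 0 < ∑ i, f i * (v i : ℝ)} =
        ⋂ v ∈ S, {f | 0 < ∑ i, f i * (v i : ℝ)} := by
      ext
      simp
    rw [this]
    exact isOpen_biInter_finset fun v _ => isOpen_lt continuous_const (by fun_prop)
  have hdense : DenseRange (Pi.map fun (_ : n) (q : ℚ) => (q : ℝ)) :=
    DenseRange.piMap fun _ => Rat.denseRange_cast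
  obtain ⟨q, hq⟩ := hdense.exists_mem_open hopen ⟨f, hf⟩
  -- The rational approximation `q` of `f`, multiplied by the product of all its denominators.
  refine ⟨fun i => (q i).num * ∏ j ∈ Finset.univ.erase i, ((q j).den : ℤ), fun v hv => ?_⟩
  have h1 : 0 < ∑ i, q i * (v i : ℚ) := by
    have := hq v hv
    simp only [Pi.map_apply] at this
    exact_mod_cast this
  have hD : (0 : ℚ) < ∏ j, ((q j).den : ℚ) :=
    Finset.prod_pos fun j _ => by exact_mod_cast (q j).den_pos
  have h2 := mul_pos h1 hD
  rw [Finset.sum_mul] at h2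
  have h3 : ∀ i, q i * (v i : ℚ) * ∏ j, ((q j).den : ℚ) =
      (((q i).num * ∏ j ∈ Finset.univ.erase i, ((q j).den : ℤ)) * v i : ℤ) := by
    intro i
    rw [← Finset.mul_prod_erase _ _ (Finset.mem_univ i)]
    push_cast
    rw [← Rat.mul_den_eq_num (q i)]
    ring
  simp only [h3] at h2
  exact_mod_cast h2

/-- Vectors without a nontrivial nonnegative linear relation lie in an open half space. -/
theorem exists_pos_of_salient {n : Type*} [Fintype n] (S : Finset (n → ℝ))
    (hsal : ∀ c : (n → ℝ) → ℝ, (∀ v ∈ S, 0 ≤ c v) → ∑ v ∈ S, c v • v = 0 → ∀ v ∈ S, c v = 0) :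
    ∃ f : n → ℝ, ∀ v ∈ S, 0 < ∑ i, f i * v i := by
  classical
  -- A convex combination equal to `0` would be a nontrivial relation; a functional separating `0`
  -- from the hull is then positive on `S`.
  have hnot : (0 : n → ℝ) ∉ convexHull ℝ (S : Set (n → ℝ)) := by
    intro h
    obtain ⟨c, hc0, hc1, hc⟩ := Finset.mem_convexHull'.1 h
    have := hsal c hc0 hc
    rw [Finset.sum_eq_zero this] at hc1
    exact zero_ne_one hc1
  obtain ⟨f, u, hu, hf⟩ := geometric_hahn_banach_point_closed (convex_convexHull ℝ _)
    (S.finite_toSet.isClosed_convexHull ℝ) hnot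
  refine ⟨fun i => f (Pi.single i 1), fun v hv => ?_⟩
  have h1 := hf v (subset_convexHull ℝ _ hv)
  rw [map_zero] at hu
  have h2 : f v = ∑ i, f (Pi.single i 1) * v i := by
    conv_lhs => rw [pi_eq_sum_univ' v]
    simp [map_sum, mul_comm]
  rw [← h2]
  exact hu.trans h1

theorem mem_dualMonoid_of_generators {N : Type*} [AddCommGroup N] {σ : PointedCone ℝ (ℝ ⊗[ℤ] N)} {S : Finset N}
    (hS : σ = PointedCone.hull ℝ ((fun v : N => (1 : ℝ) ⊗ₜ[ℤ] v) '' (S : Set N)))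
    {u : Module.Dual ℤ N} (hu : ∀ v ∈ S, 0 ≤ u v) : u ∈ dualMonoid σ := by
  intro x hx
  rw [hS] at hx
  induction hx using Submodule.span_induction with
  | mem x hx =>
    obtain ⟨v, hv, rfl⟩ := hx
    simpa using hu v hv
  | zero => simp
  | add x y _ _ hx hy => simpa using add_nonneg hx hy
  | smul c x _ hx =>
    have : c • x = (c : ℝ) • x := rfl
    rw [this, map_smul, smul_eq_mul]
    exact mul_nonneg c.2 hx

variable {N : Type*} [AddCommGroup N] [Module.Free ℤ N] [Module.Finite ℤ N]

theorem one_tmul_injective : Function.Injective fun v : N => (1 : ℝ) ⊗ₜ[ℤ] v := by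
  intro v w h
  let e := Module.finBasis ℤ N
  apply e.repr.injective
  ext i
  have := congrArg (fun x => (e.baseChange ℝ).repr x i) h
  simpa [Module.Basis.baseChange_repr_tmul] using this

/-- A salient rational cone has a dual vector that is positive on all nonzero generators. -/
theorem exists_dual_pos_of_salient {σ : PointedCone ℝ (ℝ ⊗[ℤ] N)} {S : Finset N}
    (hS : σ = PointedCone.hull ℝ ((fun v : N => (1 : ℝ) ⊗ₜ[ℤ] v) '' (S : Set N)))
    (hsal : σ.toConvexCone.Salient) :
    ∃ u : Module.Dual ℤ N, ∀ v ∈ S, v ≠ 0 → 0 < u v := by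
  classical
  let e := Module.finBasis ℤ N
  let eR := (e.baseChange ℝ).equivFun
  let S' := S.filter (· ≠ 0)
  let E : N → Fin (Module.finrank ℤ N) → ℝ := fun v => eR ((1 : ℝ) ⊗ₜ[ℤ] v)
  have hE : Function.Injective E := eR.injective.comp one_tmul_injective
  have hEcoord : ∀ v i, E v i = (e.repr v i : ℝ) := fun v i => by
    simp [E, eR, Module.Basis.baseChange_repr_tmul]
  have hmem : ∀ v ∈ S, (1 : ℝ) ⊗ₜ[ℤ] v ∈ σ := fun v hv => by
    rw [hS]
    exact Submodule.subset_span ⟨v, hv, rfl⟩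
  obtain ⟨f, hf⟩ := exists_pos_of_salient (S'.image E) (by
      intro c hc hsum
      rw [Finset.sum_image hE.injOn] at hsum
      have hsum' : ∑ v ∈ S', c (E v) • ((1 : ℝ) ⊗ₜ[ℤ] v) = 0 := by
        apply eR.injective
        rw [map_sum, map_zero, ← hsum]
        exact Finset.sum_congr rfl fun v _ => map_smul _ _ _
      intro x hx
      obtain ⟨v, hv, rfl⟩ := Finset.mem_image.1 hx
      by_contra hcv
      have hsm : ∀ v ∈ S', c (E v) • ((1 : ℝ) ⊗ₜ[ℤ] v) ∈ σ := fun v hv =>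
        σ.smul_mem (hc _ (Finset.mem_image_of_mem E hv))
          (hmem v (Finset.mem_filter.1 hv).1)
      refine hsal (c (E v) • ((1 : ℝ) ⊗ₜ[ℤ] v)) (hsm v hv) ?_ ?_
      · rw [smul_ne_zero_iff]
        refine ⟨hcv, fun h => (Finset.mem_filter.1 hv).2 (one_tmul_injective (h.trans ?_))⟩
        simp
      -- The negative of one summand of the relation is the sum of the others, so both signs lie in
      -- `σ`, against salience.
      · rw [← Finset.add_sum_erase _ _ hv, add_eq_zero_iff_eq_neg'] at hsum'
        rw [← hsum']
        exact (sum_mem fun w hw => hsm w (Finset.mem_of_mem_erase hw) : _ ∈ σ))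
  obtain ⟨z, hz⟩ := exists_integral_pos_of_real_pos (S'.image fun v i => e.repr v i) f (by
    intro x hx
    obtain ⟨v, hv, rfl⟩ := Finset.mem_image.1 hx
    simpa only [hEcoord] using hf (E v) (Finset.mem_image_of_mem E hv))
  refine ⟨e.constr ℤ z, fun v hv hv0 => ?_⟩
  have := hz _ (Finset.mem_image_of_mem _ (Finset.mem_filter.2 ⟨hv, hv0⟩))
  rw [Module.Basis.constr_apply_fintype]
  simpa [mul_comm] using this

/-- The semigroup of a salient rational cone generates the lattice. -/
theorem exists_sub_of_salient {σ : PointedCone ℝ (ℝ ⊗[ℤ] N)} (hσ : IsRationalPolyhedral σ)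
    (hsal : σ.toConvexCone.Salient) (u : Module.Dual ℤ N) :
    ∃ s t : dualMonoid σ, u = (s : Module.Dual ℤ N) - t := by
  classical
  obtain ⟨S, hS⟩ := hσ
  obtain ⟨u₀, hu₀⟩ := exists_dual_pos_of_salient hS hsal
  -- As `u₀` is at least `1` on each nonzero generator, `K • u₀` dominates `|u|` on all of them.
  let K : ℤ := ∑ v ∈ S, |u v|
  have hK : 0 ≤ K := Finset.sum_nonneg fun v _ => abs_nonneg _
  have hpos : ∀ v ∈ S, 0 ≤ u₀ v := by
    intro v hv
    by_cases hv0 : v = 0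
    · simp [hv0]
    · exact (hu₀ v hv hv0).le
  refine ⟨⟨u + K • u₀, mem_dualMonoid_of_generators hS fun v hv => ?_⟩,
    ⟨K • u₀, mem_dualMonoid_of_generators hS fun v hv => ?_⟩, by simp⟩
  · by_cases hv0 : v = 0
    · simp [hv0]
    · have h1 := hu₀ v hv hv0
      have h2 : |u v| ≤ K := Finset.single_le_sum (f := fun v => |u v|)
        (fun v _ => abs_nonneg _) hv
      have h3 := neg_abs_le (u v)
      simp only [LinearMap.add_apply, LinearMap.smul_apply, smul_eq_mul]
      nlinarith
  · simpa using mul_nonneg hK (hpos v hv)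

theorem closure_eq_top_of_adjoin_chi {k : Type*} [Field k] {S : Type*} [AddCommMonoid S]
    {G : Set S} (hG : Algebra.adjoin k (chi k '' G) = ⊤) : AddSubmonoid.closure G = ⊤ := by
  refine eq_top_iff.2 fun u _ => ?_
  apply AddMonoidAlgebra.mem_closure_of_mem_span_closure (R := k)
  have : chi k u ∈ Algebra.adjoin k (chi k '' G) := hG ▸ Algebra.mem_top
  rw [← Subalgebra.mem_toSubmodule, Algebra.adjoin_eq_span] at this
  exact this

end Cone

/-! ### The weight filtration, `Φ(a)` and the dimension of the stabilizer -/

section Main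

variable {N : Type*} [AddCommGroup N]

/-- The value `⟨a, u⟩` as a natural number. -/
def dualMonoidWeight {σ : PointedCone ℝ (ℝ ⊗[ℤ] N)} (a : N) (u : dualMonoid σ) : ℕ :=
  ((u : Module.Dual ℤ N) a).toNat

theorem dualMonoidWeight_cast {σ : PointedCone ℝ (ℝ ⊗[ℤ] N)} {a : N}
    (ha : (1 : ℝ) ⊗ₜ[ℤ] a ∈ σ) (u : dualMonoid σ) :
    (dualMonoidWeight a u : ℤ) = (u : Module.Dual ℤ N) a :=
  Int.toNat_of_nonneg (dualMonoid_apply_nonneg ha u)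

theorem dualMonoidWeight_add {σ : PointedCone ℝ (ℝ ⊗[ℤ] N)} {a : N}
    (ha : (1 : ℝ) ⊗ₜ[ℤ] a ∈ σ) (u v : dualMonoid σ) :
    dualMonoidWeight a (u + v) = dualMonoidWeight a u + dualMonoidWeight a v := by
  zify
  simp [dualMonoidWeight_cast ha]

/-- The sublattice generated by the elements of `G` of weight at most `j`. -/
def weightSpan {σ : PointedCone ℝ (ℝ ⊗[ℤ] N)} (G : Set (dualMonoid σ)) (a : N) (j : ℕ) :
    Submodule ℤ (Module.Dual ℤ N) :=
  Submodule.span ℤ (Subtype.val '' {g ∈ G | dualMonoidWeight a g ≤ j})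

theorem weightSpan_mono {σ : PointedCone ℝ (ℝ ⊗[ℤ] N)} (G : Set (dualMonoid σ)) (a : N) :
    Monotone (weightSpan G a) :=
  fun _ _ h => Submodule.span_mono (Set.image_mono fun _ hg => ⟨hg.1, hg.2.trans h⟩)

/-- Weights are additive and nonnegative, so no generator in a decomposition of `u` weighs more than
`u`. -/
theorem mem_weightSpan {σ : PointedCone ℝ (ℝ ⊗[ℤ] N)} {a : N}
    (ha : (1 : ℝ) ⊗ₜ[ℤ] a ∈ σ) {G : Set (dualMonoid σ)} (hG : AddSubmonoid.closure G = ⊤)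
    (u : dualMonoid σ) : (u : Module.Dual ℤ N) ∈ weightSpan G a (dualMonoidWeight a u) := by
  have hu : u ∈ AddSubmonoid.closure G := hG ▸ AddSubmonoid.mem_top u
  induction hu using AddSubmonoid.closure_induction with
  | mem u hu => exact Submodule.subset_span ⟨u, ⟨hu, le_rfl⟩, rfl⟩
  | zero => exact zero_mem _
  | add u v _ _ hu hv =>
    rw [dualMonoidWeight_add ha]
    exact add_mem (weightSpan_mono G a (Nat.le_add_right _ _) hu)
      (weightSpan_mono G a (Nat.le_add_left _ _) hv)

/-- A nonzero determinant matches each `u i` with a basis vector `b (π i)` occurring in its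
expansion; adaptedness then gives `w (π i) ≤ ⟨a, u i⟩`. -/
theorem sum_weights_le {σ : PointedCone ℝ (ℝ ⊗[ℤ] N)} {a : N}
    {b : Module.Basis (Fin (Module.finrank ℤ N)) ℤ (Module.Dual ℤ N)}
    {w : Fin (Module.finrank ℤ N) → ℕ}
    (hb : ∀ u : dualMonoid σ, (u : Module.Dual ℤ N) ∈
      Submodule.span ℤ (b '' {i | w i ≤ dualMonoidWeight a u}))
    {u : Fin (Module.finrank ℤ N) → dualMonoid σ} (hu : IsSpanningTuple u) :
    ∑ i, w i ≤ ∑ i, dualMonoidWeight a (u i) := by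
  obtain ⟨π, hπ⟩ := exists_perm_repr_ne_zero b ((span_tmul_eq_top_iff_det_ne_zero b _).1 hu)
  rw [← Equiv.sum_comp π w]
  refine Finset.sum_le_sum fun i _ => ?_
  have := b.repr_support_subset_of_mem_span _ (hb (u i))
  exact this (Finsupp.mem_support_iff.2 (hπ i))

/-- Exchange yields spanning generators of weights at most `w i`; the lower bound on the sum forces
equality term by term. -/
theorem exists_spanningTuple_weights {σ : PointedCone ℝ (ℝ ⊗[ℤ] N)} {a : N}
    {G : Set (dualMonoid σ)}
    {b : Module.Basis (Fin (Module.finrank ℤ N)) ℤ (Module.Dual ℤ N)}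
    {w : Fin (Module.finrank ℤ N) → ℕ}
    (hb : ∀ u : dualMonoid σ, (u : Module.Dual ℤ N) ∈
      Submodule.span ℤ (b '' {i | w i ≤ dualMonoidWeight a u}))
    (hbG : ∀ i, b i ∈ (weightSpan G a (w i)).saturation) :
    ∃ u : Fin (Module.finrank ℤ N) → dualMonoid σ, (∀ i, u i ∈ G) ∧ IsSpanningTuple u ∧
      ∀ i, dualMonoidWeight a (u i) = w i := by
  obtain ⟨v, hv, hdet⟩ := exists_det_ne_zero_of_mem_saturation b _ hbG
  choose u hu huv using hv
  obtain rfl : (fun i => (u i : Module.Dual ℤ N)) = v := funext huv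
  have hspan : IsSpanningTuple u := (span_tmul_eq_top_iff_det_ne_zero b _).2 hdet
  refine ⟨u, fun i => (hu i).1, hspan, fun i => ?_⟩
  have h1 : ∀ i ∈ Finset.univ, dualMonoidWeight a (u i) ≤ w i := fun i _ => (hu i).2
  exact (Finset.sum_eq_sum_iff_of_le h1).1
    (le_antisymm (Finset.sum_le_sum h1) (sum_weights_le hb hspan)) i (Finset.mem_univ i)

/-- The upper bound uses multiples of the `b i` lying in the span of generators, the lower bound
uses that the `b i` generate every `u` without exceeding its weight. -/
theorem topologicalKrullDim_stabilizer {k : Type*} [Field k] [CharZero k]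
    {σ : PointedCone ℝ (ℝ ⊗[ℤ] N)} {a : N} {G : Set (dualMonoid σ)} {m : ℕ}
    {γ : JetPoint k m (AddMonoidAlgebra k (dualMonoid σ))} (hγ : γ ∈ jetOrbit k σ m a)
    {b : Module.Basis (Fin (Module.finrank ℤ N)) ℤ (Module.Dual ℤ N)}
    {w : Fin (Module.finrank ℤ N) → ℕ}
    (hb : ∀ u : dualMonoid σ, (u : Module.Dual ℤ N) ∈
      Submodule.span ℤ (b '' {i | w i ≤ dualMonoidWeight a u}))
    (hbG : ∀ i, b i ∈ (weightSpan G a (w i)).saturation) :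
    topologicalKrullDim
      (MulAction.stabilizer (JetPoint k m (AddMonoidAlgebra k (Module.Dual ℤ N))) γ) =
        ((∑ i, min (w i) (m + 1) : ℕ) : WithBot ℕ∞) := by
  have hmono : ∀ (g : JetPoint k m (AddMonoidAlgebra k (Module.Dual ℤ N))) {i j : ℕ}, i ≤ j →
      g.congruentOne (JetRing.orderIdeal k m (m + 1 - i)) ≤
        g.congruentOne (JetRing.orderIdeal k m (m + 1 - j)) :=
    fun g i j h u hu => JetRing.orderIdeal_anti (Nat.sub_le_sub_left h _) hu
  rw [← card_freeCoefficient w m]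
  let H : Subgroup (JetPoint k m (AddMonoidAlgebra k (Module.Dual ℤ N))) :=
    MulAction.stabilizer _ γ
  refine le_antisymm ?_ ?_
  · choose c hc hcb using hbG
    refine topologicalKrullDim_le_freeCoefficient b w (fun i => (c i).natAbs)
      (fun i => Int.natAbs_ne_zero.2 (hc i)) (H : Set (JetPoint k m (AddMonoidAlgebra k (Module.Dual ℤ N)))) fun g hg i hi => ?_
    have hg := (mem_stabilizer_jetOrbit_iff hγ g).1 hg
    have hle : weightSpan G a (w i) ≤
        g.congruentOne (JetRing.orderIdeal k m (m + 1 - w i)) := by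
      refine Submodule.span_le.2 ?_
      rintro _ ⟨u, ⟨-, hu⟩, rfl⟩
      exact hmono g hu (hg u (hu.trans hi))
    have h := hle (hcb i)
    rw [← natCast_zsmul]
    rcases Int.natAbs_eq (c i) with h1 | h1
    · rwa [← h1]
    · rw [h1, neg_smul, neg_mem_iff] at h
      exact h
  · refine freeCoefficient_le_topologicalKrullDim b w (H : Set (JetPoint k m (AddMonoidAlgebra k (Module.Dual ℤ N)))) fun g hg => ?_
    refine (mem_stabilizer_jetOrbit_iff hγ g).2 fun u hu => ?_
    refine (Submodule.span_le.2 ?_) (hb u)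
    rintro _ ⟨i, hi, rfl⟩
    exact hmono g hi (hg i (le_trans hi hu))

variable [Module.Free ℤ N] [Module.Finite ℤ N]

/-- A basis of the dual lattice adapted to the filtration by the weights `⟨a, u⟩`. -/
theorem exists_basis_adapted_to_weights {σ : PointedCone ℝ (ℝ ⊗[ℤ] N)}
    (hσ : IsRationalPolyhedral σ) (hsal : σ.toConvexCone.Salient) {a : N}
    (ha : (1 : ℝ) ⊗ₜ[ℤ] a ∈ σ) {G : Set (dualMonoid σ)} (hG : AddSubmonoid.closure G = ⊤) :
    ∃ (b : Module.Basis (Fin (Module.finrank ℤ N)) ℤ (Module.Dual ℤ N))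
      (w : Fin (Module.finrank ℤ N) → ℕ),
      (∀ u : dualMonoid σ, (u : Module.Dual ℤ N) ∈
        Submodule.span ℤ (b '' {i | w i ≤ dualMonoidWeight a u})) ∧
      ∀ i, b i ∈ (weightSpan G a (w i)).saturation := by
  -- Generators of bounded weight may span a non-saturated sublattice, which has no adapted basis;
  -- saturating costs only a nonzero multiple of each `b i`.
  let F : ℕ → Submodule ℤ (Module.Dual ℤ N) := fun j => (weightSpan G a j).saturation
  have hF : Monotone F := fun i j h => Submodule.saturation_mono (weightSpan_mono G a h)
  have hex : ∀ u, ∃ j, u ∈ F j := by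
    intro u
    obtain ⟨s, t, rfl⟩ := exists_sub_of_salient hσ hsal u
    refine ⟨max (dualMonoidWeight a s) (dualMonoidWeight a t), Submodule.le_saturation _ ?_⟩
    exact sub_mem (weightSpan_mono G a (le_max_left _ _) (mem_weightSpan ha hG s))
      (weightSpan_mono G a (le_max_right _ _) (mem_weightSpan ha hG t))
  obtain ⟨J, hJ⟩ : ∃ J, F J = ⊤ := by
    choose j hj using fun i => hex (Module.finBasis ℤ (Module.Dual ℤ N) i)
    refine ⟨∑ i, j i, ?_⟩
    rw [eq_top_iff, ← (Module.finBasis ℤ (Module.Dual ℤ N)).span_eq, Submodule.span_le]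
    rintro _ ⟨i, rfl⟩
    exact hF (Finset.single_le_sum (fun _ _ => Nat.zero_le _) (Finset.mem_univ i)) (hj i)
  obtain ⟨ι, hι, b, w, -, hb⟩ := exists_adapted_basis J F hF
    (fun j c u hc hu => Submodule.mem_saturation_of_smul_mem hc hu) hJ
  have hcard : Fintype.card ι = Module.finrank ℤ N := by
    rw [← Module.finrank_eq_card_basis b,
      Module.finrank_eq_card_basis (Module.finBasis ℤ N).dualBasis, Fintype.card_fin]
  let e := Fintype.equivFinOfCardEq hcard
  refine ⟨b.reindex e, w ∘ e.symm, fun u => ?_, fun i => ?_⟩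
  · have h : (u : Module.Dual ℤ N) ∈ F (dualMonoidWeight a u) :=
      Submodule.le_saturation _ (mem_weightSpan ha hG u)
    rw [hb] at h
    refine Submodule.span_mono ?_ h
    rintro _ ⟨i, hi, rfl⟩
    exact ⟨e i, by simpa using hi, by simp⟩
  · rw [Module.Basis.reindex_apply]
    change b (e.symm i) ∈ F (w (e.symm i))
    rw [hb]
    exact Submodule.subset_span ⟨_, le_refl (w (e.symm i)), rfl⟩

end Main

end

theorem mainTheorem3 {k : Type*} [Field k] [IsAlgClosed k] [CharZero k]
    {N : Type*} [AddCommGroup N] [Module.Free ℤ N] [Module.Finite ℤ N]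
    (σ : PointedCone ℝ (ℝ ⊗[ℤ] N)) (hσ : IsRationalPolyhedral σ)
    (hsal : σ.toConvexCone.Salient)
    (hspan : Submodule.span ℝ (σ : Set (ℝ ⊗[ℤ] N)) = ⊤)
    (a : N) (ha : (1 : ℝ) ⊗ₜ[ℤ] a ∈ coneInterior σ)
    (G : Set (dualMonoid σ)) (hG : IsMinimalMonomialGenerators k σ G)
    (m : ℕ) (γ : JetPoint k m (AddMonoidAlgebra k (dualMonoid σ)))
    (hγ : γ ∈ jetOrbit k σ m a) :
    IsLeast (spanningSums σ a) (Phi σ a) ∧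
    ∃ d : ℕ,
      topologicalKrullDim
        (MulAction.stabilizer (JetPoint k m (AddMonoidAlgebra k (Module.Dual ℤ N))) γ) = d ∧
      ((m : ℤ) ∈ upperBounds (minimizingValues σ G a) → (d : ℤ) = Phi σ a) ∧
      ((m : ℤ) ∉ upperBounds (minimizingValues σ G a) →
        (d : ℤ) = Phi σ a ∨ ((m : ℤ) ≤ d ∧ (d : ℤ) ≤ Phi σ a)) := by
  have haσ : (1 : ℝ) ⊗ₜ[ℤ] a ∈ σ :=
    @interior_subset _ (moduleTopology ℝ (ℝ ⊗[ℤ] N)) (σ : Set (ℝ ⊗[ℤ] N)) _ ha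
  have hGcl : AddSubmonoid.closure G = ⊤ := closure_eq_top_of_adjoin_chi hG.prop
  obtain ⟨b, w, hb, hbG⟩ := exists_basis_adapted_to_weights hσ hsal haσ hGcl
  obtain ⟨v, hvG, hv, hvw⟩ := exists_spanningTuple_weights hb hbG
  have hvw' : ∀ i, (v i : Module.Dual ℤ N) a = w i := fun i => by
    rw [← dualMonoidWeight_cast haσ, hvw]
  have hleast : IsLeast (spanningSums σ a) ((∑ i, w i : ℕ) : ℤ) := by
    refine ⟨⟨v, hv, by simp [hvw']⟩, ?_⟩
    rintro _ ⟨u, hu, rfl⟩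
    simp only [← dualMonoidWeight_cast haσ]
    exact_mod_cast sum_weights_le hb hu
  -- The set has a least element, so `sInf` on `ℤ` is not a default value.
  have hPhi : Phi σ a = ((∑ i, w i : ℕ) : ℤ) := hleast.csInf_eq
  refine ⟨by rwa [hPhi], ∑ i, min (w i) (m + 1), topologicalKrullDim_stabilizer hγ hb hbG,
    fun hm => ?_, fun _ => ?_⟩
  · rw [hPhi, Nat.cast_inj]
    -- The minimizing tuple `v` takes the value `w i`, which `(∗)` bounds by `m`.
    refine Finset.sum_congr rfl fun i _ => min_eq_left ?_
    have hi : ((w i : ℕ) : ℤ) ≤ m :=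
      hm ⟨v, hvG, hv, by rw [hPhi]; simp [hvw'], i, (hvw' i).symm⟩
    omega
  · rw [hPhi]
    -- The threshold is `m + 1`, since a weight `m + 1` is not yet truncated; a larger one alone
    -- contributes `m + 1`.
    by_cases h : ∀ i, w i ≤ m + 1
    · exact Or.inl (by rw [Finset.sum_congr rfl fun i _ => min_eq_left (h i)])
    · push Not at h
      obtain ⟨i, hi⟩ := h
      refine Or.inr ⟨?_, ?_⟩
      · have := Finset.single_le_sum (f := fun i => min (w i) (m + 1))
          (fun _ _ => Nat.zero_le _) (Finset.mem_univ i)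
        rw [min_eq_right hi.le] at this
        omega
      · exact_mod_cast Finset.sum_le_sum fun i _ => min_le_left (w i) (m + 1)
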